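/- Let $X$ be a compact Kähler manifold with Kähler form $\omega$, let $\Lambda$ be the adjoint of $\alpha\mapsto\omega\wedge\alpha$, let $E$ be a holomorphic vector bundle on $X$ with a smooth Hermitian metric $H$, and let $\lambda\in\mathbb C$ be a constant. A family $k=(k_t)_{t\ge 0}$ of Hermitian metrics on $E$, smooth on $[0,\infty)\times X$, is called an exact solution if $$k^{-1}\partial_t k=-2i(\Lambda F_k-\lambda)\qquad (t\ge 0),\tag{1}$$ where $F_k$ is the curvature of the metric connection of $k_t$, i.e. of $d+k^{-1}\partial k$ in a local holomorphic frame. A family $(h_t)_{t\ge0}$ of Hermitian metrics is called an asymptotic solution of (1) if for every exact solution $k$ there is a constant $C\ge 1$ such that $$\tfrac1C\,k_t(v,v)\le h_t(v,v)\le C\,k_t(v,v)\qquad\text{for all }v\in E\text{ and all sufficiently large }t.$$ Let $g=(g_t)_{t\ge 0}$ be a family of complex-linear automorphisms of the bundle $E$, smooth on $[0,\infty)\times X$, such that for all $t\ge0$ $$\tfrac12\left(\partial_t g\,g^{-1}+(\partial_t g\,g^{-1})^*\right)=-i(\Lambda F-\lambda)+s,$$ where $^*$ is the adjoint with respect to $H$,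 $F$ is the curvature of the connection $g\circ\overline\partial_E\circ g^{-1}+(g^{*})^{-1}\circ\partial_E\circ g^{*}$ ($\overline\partial_E$ and $\partial_E$ being the $(0,1)$- and $(1,0)$-parts of the metric connection of $H$), and $s$ is a smooth $t$-dependent section of $\mathrm{End}(E)$ which is self-adjoint with respect to $H$. Suppose that $$-f(t)\,H(v,v)\le H(v,s_tv)\le f(t)\,H(v,v)\qquad\text{for all }v\in E,\ t\ge0,$$ for some smooth integrable function $f:[0,\infty)\to[0,\infty)$. Then the family of metrics $h_t(v,w):=H(g_tv,g_tw)$ is an asymptotic solution of (1). -/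

import Mathlib

open Bundle Set Filter Topology MeasureTheory
open scoped Manifold ContDiff ComplexConjugate

noncomputable section

/-! ### Unitary bases -/

section UnitaryBasis

/-- A complex basis `b` is unitary for the real `2`-form `α` if `α(b j, i b k) = δ_jk` and
`α(b j, b k) = 0`, i.e. if it is orthonormal for the form `α(u, i v) + i α(u, v)`, which is
conjugate linear in `u` and linear in `v` when `α` is of type `(1,1)`. -/
def IsUnitaryBasis {W : Type*} [AddCommGroup W] [Module ℂ W] {n : ℕ}
    (α : W [⋀^Fin 2]→ₗ[ℝ] ℝ) (b : Module.Basis (Fin n) ℂ W) : Prop :=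
  ∀ j k, α ![b j, Complex.I • b k] = (if j = k then 1 else 0) ∧ α ![b j, b k] = 0

/-- A positive form of type `(1,1)` on a complex vector space has a unitary basis. -/
theorem exists_isUnitaryBasis {W : Type*} [AddCommGroup W] [Module ℂ W] [FiniteDimensional ℂ W]
    (α : W [⋀^Fin 2]→ₗ[ℝ] ℝ)
    (hJ : ∀ u v, α ![Complex.I • u, Complex.I • v] = α ![u, v])
    (hpos : ∀ v, v ≠ 0 → 0 < α ![v, Complex.I • v]) :
    ∃ b : Module.Basis (Fin (Module.finrank ℂ W)) ℂ W, IsUnitaryBasis α b := by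
  have hupd : ∀ u w z : W, Function.update ![u, w] 0 z = ![z, w] := fun u w z => by
    ext i
    fin_cases i <;> simp
  have hadd : ∀ u v w, α ![u + v, w] = α ![u, w] + α ![v, w] := fun u v w => by
    have h := α.map_update_add ![u, w] 0 u v
    rwa [hupd, hupd, hupd] at h
  have hsmul : ∀ (c : ℝ) u w, α ![c • u, w] = c * α ![u, w] := fun c u w => by
    have h := α.map_update_smul ![u, w] 0 c u
    rwa [hupd, hupd] at h
  have hswap : ∀ u v, α ![u, v] = -α ![v, u] := fun u v => by
    have h := α.map_swap ![v, u] (i := 0) (j := 1) (by decide)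
    rw [← h]
    congr 1
    ext i
    fin_cases i <;> simp
  have hneg : ∀ u v, α ![u, -v] = -α ![u, v] := fun u v => by
    rw [hswap, hswap u v, neg_neg, ← neg_one_smul ℝ v, hsmul]
    ring
  have hI : ∀ u v, α ![Complex.I • u, v] = -α ![u, Complex.I • v] := fun u v => by
    have h := hJ u (Complex.I • v)
    rw [smul_smul, Complex.I_mul_I, neg_one_smul, hswap _ (-v)] at h
    have h2 : α ![-v, Complex.I • u] = -α ![v, Complex.I • u] := by
      have := hsmul (-1) v (Complex.I • u)
      simpa using this
    rw [h2, neg_neg] at h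
    rw [hswap, h]
  let core : InnerProductSpace.Core ℂ W :=
    { inner := fun u v => ⟨α ![u, Complex.I • v], α ![u, v]⟩
      conj_inner_symm := fun u v => by
        apply Complex.ext
        · simp only [Complex.conj_re]
          rw [hswap, hI, neg_neg]
        · simp only [Complex.conj_im]
          rw [hswap, neg_neg]
      re_inner_nonneg := fun u => by
        change 0 ≤ α ![u, Complex.I • u]
        by_cases h : u = 0
        · subst h
          have := hsmul 0 0 (Complex.I • (0 : W))
          simp only [zero_smul, zero_mul] at this
          exact this.ge
        · exact (hpos u h).le
      add_left := fun u v w => by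
        apply Complex.ext <;> simp [hadd]
      smul_left := fun u v c => by
        have hc : c • u = c.re • u + c.im • (Complex.I • u) := by
          conv_lhs => rw [← Complex.re_add_im c, add_smul, mul_smul]
          rfl
        apply Complex.ext
        · simp only [hc, hadd, hsmul, hI, hneg, smul_smul, Complex.I_mul_I, neg_one_smul,
            Complex.mul_re, Complex.conj_re, Complex.conj_im]
          ring
        · simp only [hc, hadd, hsmul, hI, Complex.mul_im, Complex.conj_re, Complex.conj_im]
          ring
      definite := fun u hu => by
        by_contra h
        have h1 : α ![u, Complex.I • u] = 0 := congrArg Complex.re hu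
        exact (hpos u h).ne' h1 }
  let _ : NormedAddCommGroup W := core.toNormedAddCommGroup
  let _ : InnerProductSpace ℂ W := InnerProductSpace.ofCore core.toCore
  let o := stdOrthonormalBasis ℂ W
  refine ⟨o.toBasis, fun j k => ?_⟩
  have h : (⟨α ![o j, Complex.I • o k], α ![o j, o k]⟩ : ℂ) = if j = k then 1 else 0 :=
    orthonormal_iff_ite.mp o.orthonormal j k
  rw [OrthonormalBasis.coe_toBasis]
  constructor
  · have := congrArg Complex.re h
    simp only at this
    rw [this]
    split_ifs <;> simp
  · have := congrArg Complex.im h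
    simp only at this
    rw [this]
    split_ifs <;> simp

end UnitaryBasis

/-! ### Kähler forms and contraction of `2`-forms -/

section Kaehler

variable (V : Type*) [NormedAddCommGroup V] [NormedSpace ℂ V]
  (X : Type*) [TopologicalSpace X] [ChartedSpace V X]

/-- The coordinate expression of a field of real `2`-forms on the complex manifold `X` in the
chart `φ`. -/
def formInChart {V : Type*} [NormedAddCommGroup V] [NormedSpace ℂ V]
    {X : Type*} [TopologicalSpace X] [ChartedSpace V X]
    (α : ∀ x : X, TangentSpace 𝓘(ℂ, V) x [⋀^Fin 2]→L[ℝ] ℝ) (φ : OpenPartialHomeomorph X V) (y : V) :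
    V [⋀^Fin 2]→L[ℝ] ℝ :=
  (α (φ.symm y)).compContinuousLinearMap
    ((mfderiv 𝓘(ℂ, V) 𝓘(ℂ, V) φ.symm y).restrictScalars ℝ)

/-- A Kähler form on the complex manifold `X`: a smooth closed positive real form of
type `(1,1)`. -/
structure KaehlerForm where
  /-- the underlying field of real `2`-forms on the tangent spaces -/
  form : ∀ x : X, TangentSpace 𝓘(ℂ, V) x [⋀^Fin 2]→L[ℝ] ℝ
  invariant : ∀ x (u v : TangentSpace 𝓘(ℂ, V) x),
    form x ![Complex.I • u, Complex.I • v] = form x ![u, v]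
  positive : ∀ x (v : TangentSpace 𝓘(ℂ, V) x), v ≠ 0 → 0 < form x ![v, Complex.I • v]
  smooth : ∀ φ ∈ atlas V X, ContDiffOn ℝ ∞ (formInChart form φ) φ.target
  closed : ∀ φ ∈ atlas V X, ∀ y ∈ φ.target, extDeriv (formInChart form φ) y = 0

variable {V X}

/-- A basis of `T_x X` which is unitary for the Kähler form. -/
def KaehlerForm.unitaryBasis [FiniteDimensional ℂ V] (κ : KaehlerForm V X) (x : X) :
    Module.Basis (Fin (Module.finrank ℂ V)) ℂ (TangentSpace 𝓘(ℂ, V) x) :=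
  haveI : FiniteDimensional ℂ (TangentSpace 𝓘(ℂ, V) x) := inferInstanceAs (FiniteDimensional ℂ V)
  (exists_isUnitaryBasis (κ.form x).toAlternatingMap (κ.invariant x) (κ.positive x)).choose

theorem KaehlerForm.isUnitaryBasis_unitaryBasis [FiniteDimensional ℂ V] (κ : KaehlerForm V X)
    (x : X) : IsUnitaryBasis (κ.form x).toAlternatingMap (κ.unitaryBasis x) :=
  haveI : FiniteDimensional ℂ (TangentSpace 𝓘(ℂ, V) x) := inferInstanceAs (FiniteDimensional ℂ V)
  (exists_isUnitaryBasis (κ.form x).toAlternatingMap (κ.invariant x) (κ.positive x)).choose_spec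

/-- The operator `Λ`, pointwise adjoint to exterior multiplication by the Kähler form, on a
`2`-form `α` at `x` with values in a vector space:
`Λ α = ∑ j, α(e_j, i e_j)` for a unitary basis `e_1, …, e_n` of `T_x X`. -/
def KaehlerForm.contract [FiniteDimensional ℂ V] (κ : KaehlerForm V X) (x : X)
    {M : Type*} [AddCommMonoid M]
    (α : TangentSpace 𝓘(ℂ, V) x → TangentSpace 𝓘(ℂ, V) x → M) : M :=
  ∑ j, α (κ.unitaryBasis x j) (Complex.I • κ.unitaryBasis x j)

end Kaehler

/-! ### Connections in local coordinates

A connection on a trivialised bundle over an open subset of `V` is `d + a`, where the matrix-valued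
`1`-form `a` is given as a function `a y u` of the base point `y` and the tangent vector `u`. -/

section Local

variable {V : Type*} [NormedAddCommGroup V] [NormedSpace ℂ V] {r : ℕ}

/-- The derivative at `y` of a matrix-valued function in the direction `u`. -/
def matD (M : V → Matrix (Fin r) (Fin r) ℂ) (y u : V) : Matrix (Fin r) (Fin r) ℂ :=
  Matrix.of fun i j => fderiv ℝ (fun z => M z i j) y u

/-- `∂M`, the complex linear part of `dM`. -/
def matDel (M : V → Matrix (Fin r) (Fin r) ℂ) (y u : V) : Matrix (Fin r) (Fin r) ℂ :=
  (1 / 2 : ℂ) • (matD M y u - Complex.I • matD M y (Complex.I • u))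

/-- `∂̄M`, the conjugate linear part of `dM`. -/
def matDelbar (M : V → Matrix (Fin r) (Fin r) ℂ) (y u : V) : Matrix (Fin r) (Fin r) ℂ :=
  (1 / 2 : ℂ) • (matD M y u + Complex.I • matD M y (Complex.I • u))

/-- The curvature `da + a ∧ a` of the connection `d + a`, evaluated at `y` on `u, v`. -/
def curvatureForm (a : V → V → Matrix (Fin r) (Fin r) ℂ) (y u v : V) :
    Matrix (Fin r) (Fin r) ℂ :=
  matD (fun z => a z v) y u - matD (fun z => a z u) y v + (a y u * a y v - a y v * a y u)

/-- The metric connection `d + h⁻¹ ∂h` of the metric with Gram matrix `h` in a holomorphic frame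
(`h i j = h(e_i, e_j)`, conjugate linear in the first slot). -/
def chernForm (h : V → Matrix (Fin r) (Fin r) ℂ) (y u : V) : Matrix (Fin r) (Fin r) ℂ :=
  (h y)⁻¹ * matDel h y u

/-- The adjoint `H⁻¹ Aᴴ H` of the matrix `A` with respect to the Gram matrix `H`. -/
def adjointMatrix (H A : Matrix (Fin r) (Fin r) ℂ) : Matrix (Fin r) (Fin r) ℂ :=
  H⁻¹ * A.conjTranspose * H

/-- The connection `g ∘ ∂̄_E ∘ g⁻¹ + (g^*)⁻¹ ∘ ∂_E ∘ g^*` in a holomorphic frame, where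
`∂̄_E = ∂̄` and `∂_E = ∂ + H⁻¹ ∂H`, the latter being the `(1,0)`-part of the metric connection
of `H`; so its connection form is
`(g^*)⁻¹ ∂(g^*) + (g^*)⁻¹ (H⁻¹ ∂H) g^* - (∂̄g) g⁻¹`. -/
def gaugeForm (H g : V → Matrix (Fin r) (Fin r) ℂ) (y u : V) : Matrix (Fin r) (Fin r) ℂ :=
  let gs : V → Matrix (Fin r) (Fin r) ℂ := fun z => adjointMatrix (H z) (g z)
  (gs y)⁻¹ * matDel gs y u + (gs y)⁻¹ * chernForm H y u * gs y - matDelbar g y u * (g y)⁻¹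

end Local

/-! ### Metrics and endomorphisms of a holomorphic vector bundle -/

section BundleDefs

variable {V : Type*} [NormedAddCommGroup V] [NormedSpace ℂ V]
  {X : Type*} [TopologicalSpace X] [ChartedSpace V X]
  (F : Type*) [NormedAddCommGroup F] [NormedSpace ℂ F] [FiniteDimensional ℂ F]
  {E : X → Type*} [∀ x, AddCommGroup (E x)] [∀ x, Module ℂ (E x)] [∀ x, TopologicalSpace (E x)]
  [TopologicalSpace (TotalSpace F E)] [FiberBundle F E] [VectorBundle ℂ F E]

/-- A field of sesquilinear forms on the fibres of `E` (conjugate linear in the first slot). -/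
abbrev SesqField {X : Type*} (E : X → Type*) [∀ x, AddCommGroup (E x)] [∀ x, Module ℂ (E x)] :=
  ∀ x, E x →ₗ⋆[ℂ] E x →ₗ[ℂ] ℂ

/-- A field of endomorphisms of the fibres of `E`. -/
abbrev EndField {X : Type*} (E : X → Type*) [∀ x, AddCommGroup (E x)] [∀ x, Module ℂ (E x)] :=
  ∀ x, Module.End ℂ (E x)

/-- The Gram matrix of a field of sesquilinear forms, at `x`, in the holomorphic frame given by the
trivialization `e`. -/
def gramMatrix (e : Trivialization F (π F E)) [MemTrivializationAtlas e] (h : SesqField E) (x : X) :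
    Matrix (Fin (Module.finrank ℂ F)) (Fin (Module.finrank ℂ F)) ℂ :=
  Matrix.of fun i j =>
    h x (e.symmₗ ℂ x (Module.finBasis ℂ F i)) (e.symmₗ ℂ x (Module.finBasis ℂ F j))

/-- The matrix of an endomorphism of `E x` in the holomorphic frame given by `e`. -/
def endMatrix (e : Trivialization F (π F E)) [MemTrivializationAtlas e] (x : X)
    (A : Module.End ℂ (E x)) :
    Matrix (Fin (Module.finrank ℂ F)) (Fin (Module.finrank ℂ F)) ℂ :=
  LinearMap.toMatrix (Module.finBasis ℂ F) (Module.finBasis ℂ F)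
    (e.linearMapAt ℂ x ∘ₗ A ∘ₗ e.symmₗ ℂ x)

/-- The endomorphism of `E x` with a given matrix in the holomorphic frame given by `e`. -/
def endOfMatrix (e : Trivialization F (π F E)) [MemTrivializationAtlas e] (x : X)
    (M : Matrix (Fin (Module.finrank ℂ F)) (Fin (Module.finrank ℂ F)) ℂ) : Module.End ℂ (E x) :=
  e.symmₗ ℂ x ∘ₗ Matrix.toLin (Module.finBasis ℂ F) (Module.finBasis ℂ F) M ∘ₗ e.linearMapAt ℂ x

/-- Each form of the field is Hermitian and positive definite. -/
def IsPosHermitian {X : Type*} {E : X → Type*} [∀ x, AddCommGroup (E x)] [∀ x, Module ℂ (E x)]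
    (h : SesqField E) : Prop :=
  ∀ x, (∀ v w : E x, conj (h x v w) = h x w v) ∧ ∀ v : E x, v ≠ 0 → 0 < (h x v v).re

variable (V)

/-- A smooth Hermitian metric on `E`. -/
structure IsHermitianMetric (h : SesqField E) : Prop where
  posHermitian : IsPosHermitian h
  smooth : ∀ (e : Trivialization F (π F E)) [MemTrivializationAtlas e], ∀ i j,
    ContMDiffOn 𝓘(ℝ, V) 𝓘(ℝ, ℂ) ∞ (fun x => gramMatrix F e h x i j) e.baseSet

/-- A family `h t`, `t ∈ [0, ∞)`, of Hermitian metrics on `E`, smooth on `[0, ∞) × X`. -/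
structure IsHermitianMetricFamily (h : ℝ → SesqField E) : Prop where
  posHermitian : ∀ t, 0 ≤ t → IsPosHermitian (h t)
  smooth : ∀ (e : Trivialization F (π F E)) [MemTrivializationAtlas e], ∀ i j,
    ContMDiffOn (𝓘(ℝ, ℝ).prod 𝓘(ℝ, V)) 𝓘(ℝ, ℂ) ∞
      (fun p : ℝ × X => gramMatrix F e (h p.1) p.2 i j) (Ici 0 ×ˢ e.baseSet)

/-- A family `A t`, `t ∈ [0, ∞)`, of sections of `End E`, smooth on `[0, ∞) × X`. -/
def IsSmoothEndFamily (A : ℝ → EndField E) : Prop :=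
  ∀ (e : Trivialization F (π F E)) [MemTrivializationAtlas e], ∀ i j,
    ContMDiffOn (𝓘(ℝ, ℝ).prod 𝓘(ℝ, V)) 𝓘(ℝ, ℂ) ∞
      (fun p : ℝ × X => endMatrix F e p.2 (A p.1 p.2) i j) (Ici 0 ×ˢ e.baseSet)

/-- The derivative `∂_t A` at time `t ∈ [0, ∞)` of a family of sections of `End E`
(one-sided at `t = 0`). -/
def timeDeriv (A : ℝ → EndField E) (t : ℝ) : EndField E := fun x =>
  endOfMatrix F (trivializationAt F E x) x
    (Matrix.of fun i j =>
      derivWithin (fun τ => endMatrix F (trivializationAt F E x) x (A τ x) i j) (Ici 0) t)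

variable {V}

/-- `Λ` of the curvature at `x` of the connection given, in the preferred chart and the preferred
holomorphic trivialization at `x`, by the connection form `a`. The preferred chart at `x` identifies
`T_x X` with `V`. -/
def contractedCurvature [FiniteDimensional ℂ V] (κ : KaehlerForm V X) (x : X)
    (a : V → V → Matrix (Fin (Module.finrank ℂ F)) (Fin (Module.finrank ℂ F)) ℂ) :
    Module.End ℂ (E x) :=
  endOfMatrix F (trivializationAt F E x) x
    (κ.contract x fun u v => curvatureForm a (chartAt V x x) u v)

/-- `ΛF`, where `F` is the curvature of the metric connection of the Hermitian metric `h`. -/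
def metricCurvature [FiniteDimensional ℂ V] (κ : KaehlerForm V X) (h : SesqField E) :
    EndField E := fun x =>
  contractedCurvature F κ x <| chernForm
    fun y => gramMatrix F (trivializationAt F E x) h ((chartAt V x).symm y)

/-- `ΛF`, where `F` is the curvature of the connection `g ∘ ∂̄_E ∘ g⁻¹ + (g^*)⁻¹ ∘ ∂_E ∘ g^*`
defined by the reference metric `H` and the gauge transformation `g`. -/
def gaugeCurvature [FiniteDimensional ℂ V] (κ : KaehlerForm V X) (H : SesqField E)
    (g : EndField E) : EndField E := fun x =>
  contractedCurvature F κ x <| gaugeForm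
    (fun y => gramMatrix F (trivializationAt F E x) H ((chartAt V x).symm y))
    (fun y => endMatrix F (trivializationAt F E x) ((chartAt V x).symm y) (g ((chartAt V x).symm y)))

/-! ### The flows -/

/-- `h` is an exact solution, on `[0, ∞)`, of `h⁻¹ ∂_t h = -2 i (ΛF - lam)`. Here `h⁻¹ ∂_t h` is the
endomorphism `A` of `E` with `∂_t h(v, w) = h(v, A w)`. -/
structure IsExactSolution [FiniteDimensional ℂ V] (κ : KaehlerForm V X) (lam : ℂ)
    (h : ℝ → SesqField E) : Prop where
  metric : IsHermitianMetricFamily V F h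
  flow : ∀ t, 0 ≤ t → ∀ x, ∀ v w : E x,
    HasDerivWithinAt (fun τ => h τ x v w)
      (h t x v ((-(2 * Complex.I) • (metricCurvature F κ (h t) x - lam • 1)) w)) (Ici 0) t

/-- `h` is an asymptotic solution of `h⁻¹ ∂_t h = -2 i (ΛF - lam)`: it is uniformly comparable, for
all large `t`, to any exact solution. -/
def IsAsymptoticSolution [FiniteDimensional ℂ V] (κ : KaehlerForm V X) (lam : ℂ)
    (h : ℝ → SesqField E) : Prop :=
  ∀ k : ℝ → SesqField E, IsExactSolution F κ lam k →
    ∃ C : ℝ, 1 ≤ C ∧ ∀ᶠ t in atTop, ∀ x, ∀ v : E x,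
      C⁻¹ * (k t x v v).re ≤ (h t x v v).re ∧ (h t x v v).re ≤ C * (k t x v v).re

/-- `g` satisfies
`(1/2) (∂_t g g⁻¹ + (∂_t g g⁻¹)^*) = -i (ΛF - lam) + s` for `t ∈ [0, ∞)`, where the adjoint is taken
with respect to `H`; both sides are applied to `w` and paired with `v` by means of `H`. -/
def SolvesGaugeFlowUpTo [FiniteDimensional ℂ V] (κ : KaehlerForm V X) (lam : ℂ)
    (H : SesqField E) (g : ℝ → ∀ x, E x ≃ₗ[ℂ] E x) (s : ℝ → EndField E) : Prop :=
  ∀ t, 0 ≤ t → ∀ x, ∀ v w : E x,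
    let B : Module.End ℂ (E x) := timeDeriv F (fun τ y => (g τ y : Module.End ℂ (E y))) t x ∘ₗ
      ((g t x).symm : Module.End ℂ (E x))
    (1 / 2 : ℂ) * (H x v (B w) + H x (B v) w) =
      H x v ((-Complex.I • (gaugeCurvature F κ H (fun y => (g t y : Module.End ℂ (E y))) x - lam • 1)
        + s t x) w)

/-- The metric `H(g _, g _)`. -/
def pullbackMetric {X : Type*} {E : X → Type*} [∀ x, AddCommGroup (E x)] [∀ x, Module ℂ (E x)]
    (H : SesqField E) (g : ∀ x, E x ≃ₗ[ℂ] E x) : SesqField E := fun x =>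
  ((H x).comp (g x : E x →ₗ[ℂ] E x)).compl₂ (g x : E x →ₗ[ℂ] E x)

end BundleDefs

end

/-! Put `h_t = H(g_t·, g_t·)`. The connection built from `H` and `g` is the image under `g` of the
metric connection of `h_t`, so its curvature is conjugate by `g` to that of `h_t`
(`gaugeCurvature_apply`). The gauge equation then reads `h⁻¹∂_t h = -2i(ΛF_h - λ) + 2 g⁻¹ s g`. The
bound on `s` makes `h` both a subsolution and a supersolution of the flow, with error `2f·h`.

The rest is a comparison principle (`exists_comparison`): if `h` is a subsolution with error `a` and
`k` a supersolution with error `b`, then `h ≤ C exp(∫(a+b)) k`. It is used for `h` against an exact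
solution `k`, and for `k` against `h`. Integrability of `f` bounds the exponential, which gives the
two-sided estimate.

The comparison is a maximum principle for the form `P = ρk - h` (`comparison_of_strict`). Suppose
`P` first degenerates at time `t₀`, at a point `x₀`, on a vector `v`. Then `P ≥ 0` at time `t₀`,
with equality on `v`. The key point is that curvatures compare on `v`
(`curvatureForm_le_of_touching`): on the complex line in the direction `u`, extend `v` to the
section `v + zw` with `w = -a_k v`, where `a_k = k⁻¹∂k`, so that its `(1,0)`-derivative for `k`
vanishes at `x₀`. The second variations of `P` along `u` and `iu` are nonnegative. Together with the
identity `h·(-2iF(u, iu)) = Δ_u h - 4 a*ha`, where `Δ_u` is the sum of the second derivatives along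
`u` and `iu`, they give `h(v, -2iF_h v) + 4|a_h v + w|²_h ≤ ρ k(v, -2iF_k v)`. Summing over a
unitary basis gives `ΛF`. Since `∂_t P(v, v) ≤ 0` at `t₀`, this contradicts `ρ' > (a + b)ρ`. -/

noncomputable section

/-! ### Calculus of matrix-valued functions -/

section MatrixCalculus

open Matrix

variable {V : Type*} [NormedAddCommGroup V] [NormedSpace ℂ V] {r : ℕ}

/-- A matrix-valued function all of whose entries are of class `C^n` at `y`. -/
def MatContDiffAt (n : WithTop ℕ∞) (M : V → Matrix (Fin r) (Fin r) ℂ) (y : V) : Prop :=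
  ∀ i j, ContDiffAt ℝ n (fun z => M z i j) y

variable {n : WithTop ℕ∞} {M N : V → Matrix (Fin r) (Fin r) ℂ} {y : V}

theorem MatContDiffAt.of_le {m : WithTop ℕ∞} (h : MatContDiffAt n M y) (hmn : m ≤ n) :
    MatContDiffAt m M y :=
  fun i j => (h i j).of_le hmn

theorem MatContDiffAt.congr (h : MatContDiffAt n M y) (hMN : N =ᶠ[𝓝 y] M) :
    MatContDiffAt n N y :=
  fun i j => (h i j).congr_of_eventuallyEq (hMN.mono fun z hz => by simp only [hz])

theorem MatContDiffAt.mul (hM : MatContDiffAt n M y) (hN : MatContDiffAt n N y) :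
    MatContDiffAt n (fun z => M z * N z) y := fun i j => by
  simp only [Matrix.mul_apply]
  exact ContDiffAt.sum fun k _ => (hM i k).mul (hN k j)

theorem MatContDiffAt.sub (hM : MatContDiffAt n M y) (hN : MatContDiffAt n N y) :
    MatContDiffAt n (fun z => M z - N z) y := fun i j => (hM i j).sub (hN i j)

theorem MatContDiffAt.const_smul (hM : MatContDiffAt n M y) (c : ℂ) :
    MatContDiffAt n (fun z => c • M z) y := fun i j => contDiffAt_const.mul (hM i j)

theorem MatContDiffAt.conjTranspose (hM : MatContDiffAt n M y) :
    MatContDiffAt n (fun z => (M z)ᴴ) y := fun i j =>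
  (Complex.conjCLE.contDiff.contDiffAt).comp y (hM j i)

theorem MatContDiffAt.det (hM : MatContDiffAt n M y) :
    ContDiffAt ℝ n (fun z => (M z).det) y := by
  simp only [Matrix.det_apply']
  exact ContDiffAt.sum fun σ _ => contDiffAt_const.mul (contDiffAt_prod fun i _ => hM _ _)

/-- Cramer's rule: the entries of the adjugate are determinants of matrices with one row replaced by
a constant one. -/
theorem MatContDiffAt.inv (hM : MatContDiffAt n M y) (h0 : (M y).det ≠ 0) :
    MatContDiffAt n (fun z => (M z)⁻¹) y := fun i j => by
  simp only [Matrix.inv_def, Ring.inverse_eq_inv', Matrix.smul_apply, smul_eq_mul,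
    Matrix.adjugate_apply]
  refine (hM.det.inv h0).mul (MatContDiffAt.det fun k l => ?_)
  by_cases hk : k = j
  · subst hk
    simp only [Matrix.updateRow_self]
    exact contDiffAt_const
  · simp only [Matrix.updateRow_ne hk]
    exact hM k l

theorem MatContDiffAt.differentiableAt (hM : MatContDiffAt n M y) (hn : 1 ≤ n) (i j : Fin r) :
    DifferentiableAt ℝ (fun z => M z i j) y :=
  (hM i j).differentiableAt (by rintro rfl; simp at hn)

/-- The order is finite because being `C^∞` at a point need not persist at nearby points, whereas
`C^m` does. -/
theorem MatContDiffAt.eventually {m : ℕ} (hM : MatContDiffAt m M y) :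
    ∀ᶠ z in 𝓝 y, MatContDiffAt m M z := by
  simp only [MatContDiffAt, eventually_all]
  exact fun i j => (hM i j).eventually (by simp)

theorem MatContDiffAt.eventually_det_ne_zero (hM : MatContDiffAt n M y) (h0 : (M y).det ≠ 0) :
    ∀ᶠ z in 𝓝 y, (M z).det ≠ 0 :=
  hM.det.continuousAt.eventually_ne h0

theorem MatContDiffAt.matD {m : WithTop ℕ∞} (hM : MatContDiffAt n M y) (hmn : m + 1 ≤ n) (u : V) :
    MatContDiffAt m (fun z => matD M z u) y := fun i j =>
  ((hM i j).fderiv_right hmn).clm_apply contDiffAt_const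

theorem MatContDiffAt.matDel {m : WithTop ℕ∞} (hM : MatContDiffAt n M y) (hmn : m + 1 ≤ n) (u : V) :
    MatContDiffAt m (fun z => matDel M z u) y :=
  ((hM.matD hmn u).sub ((hM.matD hmn _).const_smul _)).const_smul _

/-! ### Rules for `d`, `∂` and `∂̄` of matrix-valued functions -/

theorem matD_congr (h : M =ᶠ[𝓝 y] N) (u : V) : matD M y u = matD N y u := by
  ext i j
  have : (fun z => M z i j) =ᶠ[𝓝 y] fun z => N z i j := h.mono fun z hz => by simp only [hz]
  simp only [matD, Matrix.of_apply, this.fderiv_eq]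

theorem matD_mul (hM : MatContDiffAt 1 M y) (hN : MatContDiffAt 1 N y) (u : V) :
    matD (fun z => M z * N z) y u = matD M y u * N y + M y * matD N y u := by
  ext i j
  simp only [matD, Matrix.of_apply, Matrix.add_apply, Matrix.mul_apply]
  have h : HasFDerivAt (fun z => ∑ k, M z i k * N z k j)
      (∑ k, (M y i k • fderiv ℝ (fun z => N z k j) y +
        N y k j • fderiv ℝ (fun z => M z i k) y)) y :=
    HasFDerivAt.fun_sum fun k _ => (hM.differentiableAt le_rfl i k).hasFDerivAt.mul
      (hN.differentiableAt le_rfl k j).hasFDerivAt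
  rw [h.fderiv, ← Finset.sum_add_distrib]
  simp only [_root_.sum_apply, _root_.add_apply,
    _root_.smul_apply, smul_eq_mul]
  exact Finset.sum_congr rfl fun k _ => by ring

theorem matD_sub (hM : MatContDiffAt 1 M y) (hN : MatContDiffAt 1 N y) (u : V) :
    matD (fun z => M z - N z) y u = matD M y u - matD N y u := by
  ext i j
  exact congrArg (fun L : V →L[ℝ] ℂ => L u)
    ((hM.differentiableAt le_rfl i j).hasFDerivAt.sub
      (hN.differentiableAt le_rfl i j).hasFDerivAt).fderiv

theorem matD_const_smul (hM : MatContDiffAt 1 M y) (c : ℂ) (u : V) :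
    matD (fun z => c • M z) y u = c • matD M y u := by
  ext i j
  exact congrArg (fun L : V →L[ℝ] ℂ => L u)
    ((hM.differentiableAt le_rfl i j).hasFDerivAt.const_mul c).fderiv

theorem matD_conjTranspose (hM : MatContDiffAt 1 M y) (u : V) :
    matD (fun z => (M z)ᴴ) y u = (matD M y u)ᴴ := by
  ext i j
  exact congrArg (fun L : V →L[ℝ] ℂ => L u)
    ((Complex.conjCLE : ℂ ≃L[ℝ] ℂ).hasFDerivAt.comp y
      (hM.differentiableAt le_rfl j i).hasFDerivAt).fderiv

theorem matD_neg_dir (M : V → Matrix (Fin r) (Fin r) ℂ) (y u : V) :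
    matD M y (-u) = -matD M y u := by
  ext i j
  simp [matD]

theorem matD_I_smul_I_smul (M : V → Matrix (Fin r) (Fin r) ℂ) (y u : V) :
    matD M y (Complex.I • Complex.I • u) = -matD M y u := by
  rw [smul_smul, Complex.I_mul_I, neg_one_smul, matD_neg_dir]

/-- Type `(1,0)`: this makes the term `a ∧ a` of a metric connection vanish on the pair `(u, iu)`.
-/
theorem matDel_I_smul (M : V → Matrix (Fin r) (Fin r) ℂ) (y u : V) :
    matDel M y (Complex.I • u) = Complex.I • matDel M y u := by
  rw [matDel, matDel, matD_I_smul_I_smul, smul_comm Complex.I, smul_sub Complex.I, smul_smul,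
    Complex.I_mul_I, smul_neg, neg_one_smul, sub_neg_eq_add, sub_neg_eq_add, add_comm]

theorem matDel_add_matDelbar (M : V → Matrix (Fin r) (Fin r) ℂ) (y u : V) :
    matDel M y u + matDelbar M y u = matD M y u := by
  rw [matDel, matDelbar, ← smul_add, sub_add_add_cancel, ← two_smul ℂ, smul_smul]
  norm_num

theorem matDel_congr (h : M =ᶠ[𝓝 y] N) (u : V) : matDel M y u = matDel N y u := by
  rw [matDel, matDel, matD_congr h, matD_congr h]

theorem matDel_mul (hM : MatContDiffAt 1 M y) (hN : MatContDiffAt 1 N y) (u : V) :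
    matDel (fun z => M z * N z) y u = matDel M y u * N y + M y * matDel N y u := by
  simp only [matDel, matD_mul hM hN, smul_add, smul_sub, sub_mul, mul_sub, Matrix.smul_mul,
    Matrix.mul_smul]
  abel

theorem matDelbar_eq_conjTranspose (hM : MatContDiffAt 1 M y) (hH : ∀ᶠ z in 𝓝 y, (M z)ᴴ = M z)
    (u : V) : matDelbar M y u = (matDel M y u)ᴴ := by
  have h : ∀ u, (matD M y u)ᴴ = matD M y u := fun u => by
    rw [← matD_conjTranspose hM]
    exact matD_congr hH u
  simp only [matDel, matDelbar, conjTranspose_smul, conjTranspose_sub, h]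
  simp [sub_eq_add_neg]

theorem matD_comm (hM : MatContDiffAt 2 M y) (u v : V) :
    matD (fun z => matD M z v) y u = matD (fun z => matD M z u) y v := by
  ext i j
  have hs : IsSymmSndFDerivAt ℝ (fun z => M z i j) y :=
    (hM i j).isSymmSndFDerivAt (by simp)
  have hd : DifferentiableAt ℝ (fderiv ℝ fun z => M z i j) y :=
    ((hM i j).fderiv_right (m := 1) (by norm_num)).differentiableAt (by simp)
  have key : ∀ a b : V, fderiv ℝ (fun z => fderiv ℝ (fun z => M z i j) z b) y a
      = fderiv ℝ (fderiv ℝ fun z => M z i j) y a b := fun a b => by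
    have := (hd.hasFDerivAt.clm_apply (hasFDerivAt_const b y)).fderiv
    rw [this]
    simp
  simp only [matD, Matrix.of_apply, key]
  exact hs u v

/-- The derivative of a matrix-valued function along a line, paired with two vectors. -/
theorem hasDerivAt_line (hM : MatContDiffAt 1 M y) (u : V) (a b : Fin r → ℂ) (z : V) (t : ℝ)
    (hz : z + t • u = y) :
    HasDerivAt (fun τ : ℝ => (star a ⬝ᵥ (M (z + τ • u) *ᵥ b)).re)
      (star a ⬝ᵥ (matD M y u *ᵥ b)).re t := by
  have hl : HasDerivAt (fun τ : ℝ => z + τ • u) u t := by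
    simpa using ((hasDerivAt_id t).smul_const u).const_add z
  have he : ∀ i j, HasDerivAt (fun τ : ℝ => M (z + τ • u) i j) (matD M y u i j) t := fun i j => by
    have := hM.differentiableAt le_rfl i j
    rw [← hz] at this
    have h2 := this.hasFDerivAt.comp_hasDerivAt t hl
    rw [hz] at h2
    exact h2
  simp only [dotProduct, mulVec]
  have h : HasDerivAt (fun τ : ℝ => ∑ i, star a i * ∑ j, M (z + τ • u) i j * b j)
      (∑ i, star a i * ∑ j, matD M y u i j * b j) t :=
    HasDerivAt.fun_sum fun i _ => (HasDerivAt.fun_sum fun j _ => (he i j).mul_const _).const_mul _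
  exact (Complex.reCLM.hasFDerivAt.comp_hasDerivAt t h)

end MatrixCalculus

/-! ### The curvature of a metric connection along a complex line -/

section LocalCurvature

open Matrix

variable {V : Type*} [NormedAddCommGroup V] [NormedSpace ℂ V] {r : ℕ}
  {h k : V → Matrix (Fin r) (Fin r) ℂ} {y : V}

/-- The sum of the second derivatives of `M` in the directions `u` and `i u`. -/
def matLap (M : V → Matrix (Fin r) (Fin r) ℂ) (y u : V) : Matrix (Fin r) (Fin r) ℂ :=
  matD (fun z => matD M z u) y u +
    matD (fun z => matD M z (Complex.I • u)) y (Complex.I • u)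

/-- The mixed derivatives along `u` and `iu` cancel by symmetry of the second derivative. -/
theorem four_smul_matDelbar_matDel (hh : MatContDiffAt 2 h y) (u : V) :
    (4 : ℂ) • matDelbar (fun z => matDel h z u) y u = matLap h y u := by
  have h1 : ∀ v, MatContDiffAt 1 (fun z => matD h z v) y := fun v => hh.matD (by norm_num) v
  have h2 : ∀ v, matD (fun z => matDel h z u) y v = (1 / 2 : ℂ) • (matD (fun z => matD h z u) y v -
      Complex.I • matD (fun z => matD h z (Complex.I • u)) y v) := fun v => by
    simp only [matDel]
    rw [matD_const_smul ((h1 u).sub ((h1 _).const_smul _)), matD_sub (h1 u) ((h1 _).const_smul _),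
      matD_const_smul (h1 _)]
  rw [matDelbar, h2, h2, matLap, matD_comm hh (Complex.I • u) u]
  ext i j
  simp only [Matrix.smul_apply, Matrix.add_apply, Matrix.sub_apply, smul_eq_mul]
  linear_combination (-matD (fun z => matD h z (Complex.I • u)) y (Complex.I • u) i j)
    * Complex.I_mul_I

/-- With `a = h⁻¹∂h` of type `(1,0)`, `F(u, iu) = 2i ∂̄_u a(u)`. Applying `∂̄` to `ha = ∂h` gives `h
∂̄a = ∂̄∂h - (∂̄h)a`, and `∂̄h = (∂h)* = a*h` because `h` is Hermitian. -/
theorem isHermitian_mul_curvatureForm_chernForm (hh : MatContDiffAt 2 h y)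
    (hH : ∀ᶠ z in 𝓝 y, (h z)ᴴ = h z) (h0 : (h y).det ≠ 0) (u : V) :
    h y * (-(2 * Complex.I) • curvatureForm (chernForm h) y u (Complex.I • u)) =
      matLap h y u - (4 : ℂ) • ((chernForm h y u)ᴴ * h y * chernForm h y u) := by
  have hinv : MatContDiffAt 1 (fun z => (h z)⁻¹) y := (hh.of_le (by norm_num)).inv h0
  have hdel : MatContDiffAt 1 (fun z => matDel h z u) y := hh.matDel (by norm_num) u
  have hh1 : MatContDiffAt 1 h y := hh.of_le (by norm_num)
  have ha : MatContDiffAt 1 (fun z => chernForm h z u) y := hinv.mul hdel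
  have haI : ∀ z, chernForm h z (Complex.I • u) = Complex.I • chernForm h z u := fun z => by
    rw [chernForm, matDel_I_smul, Matrix.mul_smul, chernForm]
  have hha : ∀ᶠ z in 𝓝 y, h z * chernForm h z u = matDel h z u := by
    filter_upwards [hh.eventually_det_ne_zero h0] with z hz
    rw [chernForm, Matrix.mul_nonsing_inv_cancel_left _ _ hz.isUnit]
  have hD : ∀ v, h y * matD (fun z => chernForm h z u) y v =
      matD (fun z => matDel h z u) y v - matD h y v * chernForm h y u := fun v => by
    rw [← matD_congr hha v, matD_mul hh1 ha, add_sub_cancel_left]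
  have hbar : matDelbar h y u = (chernForm h y u)ᴴ * h y := by
    rw [matDelbar_eq_conjTranspose hh1 hH, ← hha.self_of_nhds, conjTranspose_mul,
      hH.self_of_nhds]
  rw [← hbar, ← four_smul_matDelbar_matDel hh]
  simp only [curvatureForm, haI]
  rw [matD_const_smul ha]
  simp only [Matrix.mul_smul, Matrix.smul_mul, sub_self, add_zero, Matrix.mul_sub]
  rw [hD, hD, matDelbar, matDelbar]
  ext i j
  simp only [Matrix.smul_apply, Matrix.add_apply, Matrix.sub_apply, Matrix.smul_mul,
    Matrix.add_mul, smul_eq_mul]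
  linear_combination (-2 * (matD (fun z => matDel h z u) y u i j -
    (matD h y u * chernForm h y u) i j)) * Complex.I_mul_I

/-- The second derivative at a local minimum is nonnegative. -/
theorem nonneg_of_isLocalMin_of_hasDerivAt {φ φ' : ℝ → ℝ} {c : ℝ} (hmin : IsLocalMin φ 0)
    (h1 : ∀ᶠ t in 𝓝 0, HasDerivAt φ (φ' t) t) (h2 : HasDerivAt φ' c 0) : 0 ≤ c := by
  by_contra! hc
  have hφ0 : φ' 0 = 0 := hmin.hasDerivAt_eq_zero h1.self_of_nhds
  -- Only half of the second-order term is removed: `φ - (c/4)t²` still has second derivative `c/2 <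
  -- 0` at `0`, hence a local maximum there. With the local minimum of `φ` this forces `(c/4)t² ≥ 0`
  -- near `0`, which is absurd.
  have hd : deriv (fun t => -(φ t - c / 4 * t ^ 2)) =ᶠ[𝓝 0] fun t => -(φ' t - c / 2 * t) := by
    filter_upwards [h1] with t ht
    have := (ht.sub (((hasDerivAt_id t).pow 2).const_mul (c / 4))).neg
    refine HasDerivAt.deriv (this.congr_deriv ?_)
    simp
    ring
  have hdd : deriv (deriv fun t => -(φ t - c / 4 * t ^ 2)) 0 = -(c / 2) := by
    rw [hd.deriv_eq]
    have := (h2.sub ((hasDerivAt_id (0 : ℝ)).const_mul (c / 2))).neg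
    refine HasDerivAt.deriv (this.congr_deriv ?_)
    ring
  have hm : IsLocalMin (fun t => -(φ t - c / 4 * t ^ 2)) 0 := by
    refine isLocalMin_of_deriv_deriv_pos (by rw [hdd]; linarith) ?_ ?_
    · rw [hd.self_of_nhds]
      simp [hφ0]
    · exact (h1.self_of_nhds.continuousAt.sub (by fun_prop)).neg
  have h3 : ∀ᶠ t in 𝓝[≠] (0 : ℝ), False := by
    filter_upwards [nhdsWithin_le_nhds hm, nhdsWithin_le_nhds hmin, self_mem_nhdsWithin]
      with t ht1 ht2 ht3
    have h4 : 0 < t ^ 2 := sq_pos_of_ne_zero ht3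
    norm_num at ht1
    nlinarith
  exact (h3.exists).elim fun _ h => h

/-- The second variation, along a line and a linearly varying vector, of a field of forms that is
nonnegative and vanishes on a vector. -/
theorem second_variation_nonneg {P : V → Matrix (Fin r) (Fin r) ℂ} (hP : MatContDiffAt 2 P y)
    {v : Fin r → ℂ} (hpos : ∀ᶠ z in 𝓝 y, ∀ c, 0 ≤ (star c ⬝ᵥ (P z *ᵥ c)).re)
    (hv : (star v ⬝ᵥ (P y *ᵥ v)).re = 0) (u : V) (w : Fin r → ℂ) :
    0 ≤ (star v ⬝ᵥ (matD (fun z => matD P z u) y u *ᵥ v)).re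
      + 2 * ((star v ⬝ᵥ (matD P y u *ᵥ w)).re + (star w ⬝ᵥ (matD P y u *ᵥ v)).re)
      + 2 * (star w ⬝ᵥ (P y *ᵥ w)).re := by
  let q : Matrix (Fin r) (Fin r) ℂ → (Fin r → ℂ) → (Fin r → ℂ) → ℝ :=
    fun A a b => (star a ⬝ᵥ (A *ᵥ b)).re
  have hP1 : ∀ᶠ z in 𝓝 y, MatContDiffAt 1 P z :=
    (hP.of_le (m := 1) (by norm_num) : MatContDiffAt (1 : ℕ) P y).eventually
  have hline : Tendsto (fun t : ℝ => y + t • u) (𝓝 0) (𝓝 y) := by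
    have : Continuous fun t : ℝ => y + t • u := by fun_prop
    simpa using this.tendsto 0
  have hd : ∀ a b, ∀ᶠ t in 𝓝 (0 : ℝ), HasDerivAt (fun t : ℝ => q (P (y + t • u)) a b)
      (q (matD P (y + t • u) u) a b) t := fun a b => by
    filter_upwards [hline.eventually hP1] with t ht
    exact hasDerivAt_line ht u a b y t rfl
  have hdd : ∀ a b, HasDerivAt (fun t : ℝ => q (matD P (y + t • u) u) a b)
      (q (matD (fun z => matD P z u) y u) a b) 0 := fun a b =>
    hasDerivAt_line (hP.matD (by norm_num) u) u a b y 0 (by simp)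
  -- Expanding in `w` leaves only pairings of `P` with fixed vectors, which `hasDerivAt_line`
  -- differentiates.
  have hφ : ∀ t : ℝ, q (P (y + t • u)) (v + (t : ℂ) • w) (v + (t : ℂ) • w) =
      q (P (y + t • u)) v v + t * (q (P (y + t • u)) v w + q (P (y + t • u)) w v)
        + t ^ 2 * q (P (y + t • u)) w w := fun t => by
    simp only [q, star_add, star_smul, Matrix.mulVec_add, Matrix.mulVec_smul, dotProduct_add,
      add_dotProduct, smul_dotProduct, dotProduct_smul, smul_eq_mul, Complex.star_def,
      Complex.conj_ofReal, Complex.add_re, Complex.re_ofReal_mul]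
    ring
  have hmin : IsLocalMin
      (fun t : ℝ => q (P (y + t • u)) (v + (t : ℂ) • w) (v + (t : ℂ) • w)) 0 := by
    filter_upwards [hline.eventually hpos] with t ht
    have h0 : q (P (y + (0 : ℝ) • u)) (v + ((0 : ℝ) : ℂ) • w) (v + ((0 : ℝ) : ℂ) • w) = 0 := by
      simpa [q] using hv
    rw [h0]
    exact ht _
  simp only [hφ] at hmin
  have key := nonneg_of_isLocalMin_of_hasDerivAt hmin (φ' := fun t =>
      q (matD P (y + t • u) u) v v
      + ((q (P (y + t • u)) v w + q (P (y + t • u)) w v)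
        + t * (q (matD P (y + t • u) u) v w + q (matD P (y + t • u) u) w v))
      + (2 * t * q (P (y + t • u)) w w + t ^ 2 * q (matD P (y + t • u) u) w w))
      (c := q (matD (fun z => matD P z u) y u) v v +
        2 * (q (matD P y u) v w + q (matD P y u) w v) + 2 * q (P y) w w) ?_ ?_
  · exact key
  · filter_upwards [hd v v, hd v w, hd w v, hd w w] with t h1 h2 h3 h4
    refine ((h1.add ((hasDerivAt_id t).mul (h2.add h3))).add
      (((hasDerivAt_id t).pow 2).mul h4)).congr_deriv ?_
    simp
  · have e := fun a b => (hd a b).self_of_nhds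
    have i := hasDerivAt_id (0 : ℝ)
    refine (((hdd v v).add (((e v w).add (e w v)).add (i.mul ((hdd v w).add (hdd w v))))).add
      (((i.const_mul 2).mul (e w w)).add ((i.pow 2).mul (hdd w w)))).congr_deriv ?_
    simp
    ring

/-- If `h ≤ ρ k` near `y`, with equality on a vector `v` at `y`, then the curvatures of `h` and `k`
are related on `v`. -/
theorem curvatureForm_le_of_touching (hh : MatContDiffAt 2 h y) (hk : MatContDiffAt 2 k y)
    (hhH : ∀ᶠ z in 𝓝 y, (h z)ᴴ = h z) (hkH : ∀ᶠ z in 𝓝 y, (k z)ᴴ = k z)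
    (hh0 : (h y).det ≠ 0) (hk0 : (k y).det ≠ 0)
    (hh_nonneg : ∀ c, 0 ≤ (star c ⬝ᵥ (h y *ᵥ c)).re) {ρ : ℝ} {v : Fin r → ℂ}
    (hle : ∀ᶠ z in 𝓝 y, ∀ c, (star c ⬝ᵥ (h z *ᵥ c)).re ≤ ρ * (star c ⬝ᵥ (k z *ᵥ c)).re)
    (heq : (star v ⬝ᵥ (h y *ᵥ v)).re = ρ * (star v ⬝ᵥ (k y *ᵥ v)).re) (u : V) :
    (star v ⬝ᵥ (h y *ᵥ ((-(2 * Complex.I) •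
        curvatureForm (chernForm h) y u (Complex.I • u)) *ᵥ v))).re ≤
      ρ * (star v ⬝ᵥ (k y *ᵥ ((-(2 * Complex.I) •
        curvatureForm (chernForm k) y u (Complex.I • u)) *ᵥ v))).re := by
  have hh1 : MatContDiffAt 1 h y := hh.of_le (by norm_num)
  have hk1 : MatContDiffAt 1 k y := hk.of_le (by norm_num)
  let q : Matrix (Fin r) (Fin r) ℂ → (Fin r → ℂ) → (Fin r → ℂ) → ℝ :=
    fun A a b => (star a ⬝ᵥ (A *ᵥ b)).re
  have q_symm : ∀ {A : Matrix (Fin r) (Fin r) ℂ}, Aᴴ = A → ∀ a b, q A a b = q A b a :=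
    fun {A} hA a b => by
      have : star (star a ⬝ᵥ (A *ᵥ b)) = star b ⬝ᵥ (A *ᵥ a) := by
        rw [star_dotProduct, star_star, star_mulVec, hA, ← dotProduct_mulVec]
      rw [show q A b a = (star (star a ⬝ᵥ (A *ᵥ b))).re by rw [this]]
      simp [q]
  let P : V → Matrix (Fin r) (Fin r) ℂ := fun z => (ρ : ℂ) • k z - h z
  have q_sub : ∀ (A B : Matrix (Fin r) (Fin r) ℂ) a b,
      q ((ρ : ℂ) • A - B) a b = ρ * q A a b - q B a b := fun A B a b => by
    simp [q, Matrix.sub_mulVec, Matrix.smul_mulVec, dotProduct_sub, dotProduct_smul]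
  have hP : MatContDiffAt 2 P y := (hk.const_smul _).sub hh
  have hPH : ∀ u, (matD P y u)ᴴ = matD P y u := fun u => by
    rw [← matD_conjTranspose (hP.of_le (by norm_num))]
    refine matD_congr ?_ u
    filter_upwards [hhH, hkH] with z h1 h2
    simp [P, conjTranspose_sub, conjTranspose_smul, h1, h2]
  have hPD : ∀ u, matD P y u = (ρ : ℂ) • matD k y u - matD h y u := fun u => by
    rw [matD_sub (hk1.const_smul _) hh1, matD_const_smul hk1]
  have hPpos : ∀ᶠ z in 𝓝 y, ∀ c, 0 ≤ (star c ⬝ᵥ (P z *ᵥ c)).re := by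
    filter_upwards [hle] with z hz c
    change 0 ≤ q _ _ _
    rw [q_sub]
    exact sub_nonneg.mpr (hz c)
  have hPv : (star v ⬝ᵥ (P y *ᵥ v)).re = 0 := by
    change q _ _ _ = 0
    rw [q_sub]
    exact sub_eq_zero.mpr heq.symm
  set ah := chernForm h y u with hah
  set ak := chernForm k y u with hak
  -- The section `v + zw` then has zero `(1,0)`-derivative at `y` for the metric connection of `k`.
  let w := -(ak *ᵥ v)
  have s1 := second_variation_nonneg hP hPpos hPv u w
  -- Pairing `iu` with `iw` makes the extension of `v` holomorphic along the line, so that in the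
  -- sum of `s1` and `s2` the first-order terms combine into `∂P` alone (`q_del`).
  have s2 := second_variation_nonneg hP hPpos hPv (Complex.I • u) (Complex.I • w)
  have hPlap : matLap P y u = (ρ : ℂ) • matLap k y u - matLap h y u := by
    have : ∀ u, matD (fun z => matD P z u) y u = (ρ : ℂ) • matD (fun z => matD k z u) y u
        - matD (fun z => matD h z u) y u := fun u => by
      have hev : (fun z => matD P z u) =ᶠ[𝓝 y] fun z => (ρ : ℂ) • matD k z u - matD h z u := by
        filter_upwards [(hh1 : MatContDiffAt (1 : ℕ) h y).eventually,
          (hk1 : MatContDiffAt (1 : ℕ) k y).eventually] with z h1 h2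
        rw [matD_sub (MatContDiffAt.const_smul h2 _) h1, matD_const_smul h2]
      have h1 : MatContDiffAt 1 (fun z => matD h z u) y := hh.matD (by norm_num) u
      have h2 : MatContDiffAt 1 (fun z => matD k z u) y := hk.matD (by norm_num) u
      rw [matD_congr hev, matD_sub (h2.const_smul _) h1, matD_const_smul h2]
    rw [matLap, this, this, matLap, matLap, smul_add]
    abel
  have q_mul : ∀ (A B : Matrix (Fin r) (Fin r) ℂ) a b, q (A * B) a b = q A a (B *ᵥ b) :=
    fun A B a b => by simp [q, Matrix.mulVec_mulVec]
  have q_conj : ∀ (A B : Matrix (Fin r) (Fin r) ℂ) a b, q (Bᴴ * A) a b = q A (B *ᵥ a) b :=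
    fun A B a b => by
      simp only [q]
      rw [← Matrix.mulVec_mulVec, star_mulVec, dotProduct_mulVec]
  have delh : matDel h y u = h y * ah := by
    rw [hah, chernForm, Matrix.mul_nonsing_inv_cancel_left _ _ hh0.isUnit]
  have delk : matDel k y u = k y * ak := by
    rw [hak, chernForm, Matrix.mul_nonsing_inv_cancel_left _ _ hk0.isUnit]
  have q_add : ∀ (A B : Matrix (Fin r) (Fin r) ℂ) a b, q (A + B) a b = q A a b + q B a b :=
    fun A B a b => by simp [q, Matrix.add_mulVec, dotProduct_add]
  have q_four : ∀ (A B : Matrix (Fin r) (Fin r) ℂ) a b,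
      q (A - (4 : ℂ) • B) a b = q A a b - 4 * q B a b := fun A B a b => by
    simp [q, Matrix.sub_mulVec, Matrix.smul_mulVec, dotProduct_sub, dotProduct_smul]
  have q_del : q (matD P y u) w v + q (matD P y (Complex.I • u)) (Complex.I • w) v
      = 2 * q (matDel P y u) w v := by
    simp only [q, matDel, Matrix.sub_mulVec, Matrix.smul_mulVec, dotProduct_sub, dotProduct_smul,
      star_smul, smul_dotProduct, smul_eq_mul, Complex.star_def, Complex.conj_I]
    simp
  have q_delP : matDel P y u = (ρ : ℂ) • (k y * ak) - h y * ah := by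
    rw [← delh, ← delk]
    simp only [matDel, hPD]
    module
  have q_I : q (P y) (Complex.I • w) (Complex.I • w) = q (P y) w w := by
    simp only [q, Matrix.mulVec_smul, dotProduct_smul, star_smul, smul_dotProduct, smul_eq_mul,
      Complex.star_def, Complex.conj_I, ← mul_assoc]
    simp
  have ch : q (h y) v ((-(2 * Complex.I) •
        curvatureForm (chernForm h) y u (Complex.I • u)) *ᵥ v) =
      q (matLap h y u) v v - 4 * q (h y) (ah *ᵥ v) (ah *ᵥ v) := by
    rw [← q_mul, isHermitian_mul_curvatureForm_chernForm hh hhH hh0, q_four, q_mul, q_conj]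
  have ck : q (k y) v ((-(2 * Complex.I) •
        curvatureForm (chernForm k) y u (Complex.I • u)) *ᵥ v) =
      q (matLap k y u) v v - 4 * q (k y) (ak *ᵥ v) (ak *ᵥ v) := by
    rw [← q_mul, isHermitian_mul_curvatureForm_chernForm hk hkH hk0, q_four, q_mul, q_conj]
  have hlap : q (matLap P y u) v v = q (matD (fun z => matD P z u) y u) v v +
      q (matD (fun z => matD P z (Complex.I • u)) y (Complex.I • u)) v v := q_add _ _ _ _
  -- All terms in `h` other than its curvature complete to the square `4|a_h v + w|²_h`, which has
  -- the favourable sign.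
  have hsq : 0 ≤ q (h y) (ah *ᵥ v + w) (ah *ᵥ v + w) := hh_nonneg _
  have hexp : q (h y) (ah *ᵥ v + w) (ah *ᵥ v + w) = q (h y) (ah *ᵥ v) (ah *ᵥ v)
      + 2 * q (h y) w (ah *ᵥ v) + q (h y) w w := by
    have h1 : q (h y) (ah *ᵥ v + w) (ah *ᵥ v + w) = q (h y) (ah *ᵥ v) (ah *ᵥ v)
      + q (h y) (ah *ᵥ v) w + q (h y) w (ah *ᵥ v) + q (h y) w w := by
      simp only [q, star_add, Matrix.mulVec_add, dotProduct_add, add_dotProduct, Complex.add_re]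
      ring
    rw [h1, q_symm hhH.self_of_nhds _ w]
    ring
  have kw1 : q (k y) w (ak *ᵥ v) = -q (k y) (ak *ᵥ v) (ak *ᵥ v) := by
    simp [q, w]
  have kw2 : q (k y) w w = q (k y) (ak *ᵥ v) (ak *ᵥ v) := by
    simp [q, w, Matrix.mulVec_neg]
  change q (h y) v _ ≤ ρ * q (k y) v _
  rw [ch, ck]
  change 0 ≤ q _ v v + 2 * (q _ v w + q _ w v) + 2 * q _ w w at s1
  change 0 ≤ q _ v v + 2 * (q _ v _ + q _ _ v) + 2 * q _ _ _ at s2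
  rw [q_symm (hPH _) v] at s1 s2
  rw [hPlap, q_sub] at hlap
  rw [q_delP, q_sub, q_mul, q_mul] at q_del
  rw [q_I, q_sub, kw2] at s2
  rw [q_sub, kw2] at s1
  rw [kw1] at q_del
  rw [hexp] at hsq
  linarith

end LocalCurvature

/-! ### Gauge transformations -/

section Gauge

open Matrix

variable {V : Type*} [NormedAddCommGroup V] [NormedSpace ℂ V] {r : ℕ}
  {H g : V → Matrix (Fin r) (Fin r) ℂ} {y : V}

/-- The connection defined by `H` and `g` is the image under `g` of the metric connection of the
metric `H(g _, g _)`. -/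
theorem gaugeForm_mul (hH : MatContDiffAt 1 H y) (hg : MatContDiffAt 1 g y)
    (hH0 : (H y).det ≠ 0) (hg0 : (g y).det ≠ 0) (u : V) :
    gaugeForm H g y u * g y =
      g y * chernForm (fun z => (g z)ᴴ * H z * g z) y u - matD g y u := by
  set gs : V → Matrix (Fin r) (Fin r) ℂ := fun z => adjointMatrix (H z) (g z) with hgs
  have hgs1 : MatContDiffAt 1 gs y := ((hH.inv hH0).mul hg.conjTranspose).mul hH
  have hgs0 : (gs y).det ≠ 0 := by
    simp only [hgs, adjointMatrix, det_mul, det_conjTranspose, det_nonsing_inv,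
      Ring.inverse_eq_inv']
    exact mul_ne_zero (mul_ne_zero (inv_ne_zero hH0) (star_ne_zero.mpr hg0)) hH0
  -- By definition of the adjoint `H g* = gᴴ H`, so the pulled-back metric factors as `H g* g` and
  -- the Leibniz rule applies factor by factor.
  have hh : (fun z => (g z)ᴴ * H z * g z) =ᶠ[𝓝 y] fun z => (H z * gs z) * g z := by
    filter_upwards [hH.eventually_det_ne_zero hH0] with z hz
    simp only [hgs, adjointMatrix]
    rw [Matrix.mul_assoc _⁻¹, Matrix.mul_nonsing_inv_cancel_left _ _ hz.isUnit]
  rw [chernForm, matDel_congr hh, show (g y)ᴴ * H y * g y = _ from hh.self_of_nhds,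
    matDel_mul (hH.mul hgs1) hg,
    matDel_mul hH hgs1, Matrix.mul_inv_rev, Matrix.mul_inv_rev, ← matDel_add_matDelbar g, gaugeForm,
    chernForm]
  change ((gs y)⁻¹ * matDel gs y u + (gs y)⁻¹ * ((H y)⁻¹ * matDel H y u) * gs y -
    matDelbar g y u * (g y)⁻¹) * g y = _
  have c1 : ∀ A, g y * ((g y)⁻¹ * A) = A := fun A => mul_nonsing_inv_cancel_left _ _ hg0.isUnit
  have c2 : ∀ A, (gs y)⁻¹ * (gs y * A) = A := fun A => nonsing_inv_mul_cancel_left _ _ hgs0.isUnit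
  have c3 : ∀ A, (H y)⁻¹ * (H y * A) = A := fun A => nonsing_inv_mul_cancel_left _ _ hH0.isUnit
  have c4 : (g y)⁻¹ * g y = 1 := nonsing_inv_mul _ hg0.isUnit
  simp only [Matrix.mul_add, Matrix.add_mul, Matrix.sub_mul, Matrix.mul_assoc, c1, c2, c3, c4,
    Matrix.mul_one]
  abel

/-- Gauge covariance of the curvature. -/
theorem curvatureForm_mul_of_gauge {a a' : V → V → Matrix (Fin r) (Fin r) ℂ}
    (hg : MatContDiffAt 2 g y) (hg0 : (g y).det ≠ 0)
    (ha : ∀ u, MatContDiffAt 1 (fun z => a z u) y)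
    (haa' : ∀ᶠ z in 𝓝 y, ∀ u, a' z u * g z = g z * a z u - matD g z u) (u v : V) :
    curvatureForm a' y u v * g y = g y * curvatureForm a y u v := by
  have hg1 : MatContDiffAt 1 g y := hg.of_le (by norm_num)
  have hDg : ∀ u, MatContDiffAt 1 (fun z => matD g z u) y := fun u => hg.matD (by norm_num) u
  have ha' : ∀ u, MatContDiffAt 1 (fun z => a' z u) y := fun u => by
    refine (((hg1.mul (ha u)).sub (hDg u)).mul (hg1.inv hg0)).congr ?_
    filter_upwards [haa', hg1.eventually_det_ne_zero hg0] with z h1 h2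
    rw [← h1 u, mul_nonsing_inv_cancel_right _ _ h2.isUnit]
  -- The derivative of the relation `a' g = g a - dg`. On antisymmetrising in `u, v`, the second
  -- derivatives of `g` cancel.
  have hD : ∀ u v, matD (fun z => a' z v) y u * g y = matD g y u * a y v
      + g y * matD (fun z => a z v) y u - matD (fun z => matD g z v) y u
      - a' y v * matD g y u := fun u v => by
    rw [eq_sub_iff_add_eq, ← matD_mul (ha' v) hg1, ← matD_mul hg1 (ha v),
      ← matD_sub (hg1.mul (ha v)) (hDg v)]
    exact matD_congr (haa'.mono fun z hz => hz v) u
  have h0 := haa'.self_of_nhds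
  simp only [curvatureForm, Matrix.add_mul, Matrix.sub_mul, hD, Matrix.mul_assoc, h0,
    Matrix.mul_sub, Matrix.mul_add, matD_comm hg u v]
  simp only [← Matrix.mul_assoc, h0, Matrix.sub_mul]
  abel

theorem curvatureForm_gaugeForm_mul (hH : MatContDiffAt 2 H y) (hg : MatContDiffAt 2 g y)
    (hH0 : (H y).det ≠ 0) (hg0 : (g y).det ≠ 0) (u v : V) :
    curvatureForm (gaugeForm H g) y u v * g y =
      g y * curvatureForm (chernForm fun z => (g z)ᴴ * H z * g z) y u v := by
  have hh : MatContDiffAt 2 (fun z => (g z)ᴴ * H z * g z) y := (hg.conjTranspose.mul hH).mul hg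
  have hh0 : ((g y)ᴴ * H y * g y).det ≠ 0 := by
    rw [det_mul, det_mul, det_conjTranspose]
    exact mul_ne_zero (mul_ne_zero (star_ne_zero.mpr hg0) hH0) hg0
  refine curvatureForm_mul_of_gauge hg hg0
    (fun u => (((hh.of_le (by norm_num)).inv hh0).mul (hh.matDel (by norm_num) u))) ?_ u v
  have hH1 : MatContDiffAt (1 : ℕ) H y := hH.of_le (by norm_num)
  have hg1 : MatContDiffAt (1 : ℕ) g y := hg.of_le (by norm_num)
  filter_upwards [hH1.eventually, hg1.eventually, hH1.eventually_det_ne_zero hH0,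
    hg1.eventually_det_ne_zero hg0] with z h1 h2 h3 h4 u
  exact gaugeForm_mul h1 h2 h3 h4 u

end Gauge

/-! ### Holomorphic frames -/

theorem eventually_chartAt_symm_mem {V X : Type*} [TopologicalSpace V] [TopologicalSpace X]
    [ChartedSpace V X] {s : Set X} (hs : IsOpen s) {x : X} (hx : x ∈ s) :
    ∀ᶠ y in 𝓝 (chartAt V x x), (chartAt V x).symm y ∈ s := by
  have hc : ContinuousAt (chartAt V x).symm (chartAt V x x) :=
    (chartAt V x).continuousAt_symm (mem_chart_target V x)
  refine hc.eventually_mem (hs.mem_nhds ?_)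
  rwa [(chartAt V x).left_inv (mem_chart_source V x)]

section Frames

open Matrix

variable {V : Type*} [NormedAddCommGroup V] [NormedSpace ℂ V]
  {X : Type*} [TopologicalSpace X] [ChartedSpace V X]
  {F : Type*} [NormedAddCommGroup F] [NormedSpace ℂ F] [FiniteDimensional ℂ F]
  {E : X → Type*} [∀ x, AddCommGroup (E x)] [∀ x, Module ℂ (E x)] [∀ x, TopologicalSpace (E x)]
  [TopologicalSpace (TotalSpace F E)] [FiberBundle F E] [VectorBundle ℂ F E]

/-- The vector in `E x` with given components in the frame given by the trivialization `e`. -/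
def frameVec (e : Trivialization F (π F E)) [MemTrivializationAtlas e] (x : X)
    (c : Fin (Module.finrank ℂ F) → ℂ) : E x :=
  e.symmₗ ℂ x ((Module.finBasis ℂ F).equivFun.symm c)

variable {e : Trivialization F (π F E)} [MemTrivializationAtlas e] {x : X}

theorem linearMapAt_frameVec (hx : x ∈ e.baseSet) (c : Fin (Module.finrank ℂ F) → ℂ) :
    e.linearMapAt ℂ x (frameVec e x c) = (Module.finBasis ℂ F).equivFun.symm c :=
  e.linearMapAt_symmₗ hx _

theorem exists_frameVec_eq (hx : x ∈ e.baseSet) (v : E x) : ∃ c, frameVec e x c = v :=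
  ⟨(Module.finBasis ℂ F).equivFun (e.linearMapAt ℂ x v), by
    rw [frameVec, LinearEquiv.symm_apply_apply, e.symmₗ_linearMapAt hx]⟩

theorem frameVec_ne_zero (hx : x ∈ e.baseSet) {c : Fin (Module.finrank ℂ F) → ℂ} (hc : c ≠ 0) :
    frameVec e x c ≠ 0 := fun h => hc <| by
  have := linearMapAt_frameVec hx c
  rw [h, map_zero] at this
  exact (Module.finBasis ℂ F).equivFun.symm.map_eq_zero_iff.mp this.symm

@[simp]
theorem frameVec_zero : frameVec e x 0 = 0 := by
  simp [frameVec]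

theorem apply_frameVec (h : SesqField E) (a b : Fin (Module.finrank ℂ F) → ℂ) :
    h x (frameVec e x a) (frameVec e x b) = star a ⬝ᵥ (gramMatrix F e h x *ᵥ b) := by
  simp only [frameVec, Module.Basis.equivFun_symm_apply, map_sum, map_smul, LinearMap.sum_apply,
    dotProduct, mulVec, gramMatrix, Matrix.of_apply, Finset.mul_sum]
  rw [Finset.sum_comm]
  refine Finset.sum_congr rfl fun i _ => ?_
  rw [Finset.smul_sum]
  refine Finset.sum_congr rfl fun j _ => ?_
  simp only [LinearMap.map_smulₛₗ, LinearMap.smul_apply, smul_eq_mul, Pi.star_apply,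
    Complex.star_def]
  ring

theorem endOfMatrix_frameVec (hx : x ∈ e.baseSet)
    (M : Matrix (Fin (Module.finrank ℂ F)) (Fin (Module.finrank ℂ F)) ℂ)
    (c : Fin (Module.finrank ℂ F) → ℂ) :
    endOfMatrix F e x M (frameVec e x c) = frameVec e x (M *ᵥ c) := by
  rw [endOfMatrix, LinearMap.comp_apply, LinearMap.comp_apply, linearMapAt_frameVec hx, frameVec]
  congr 1
  refine (Module.finBasis ℂ F).equivFun.injective ?_
  have := LinearMap.toMatrix_mulVec_repr (Module.finBasis ℂ F) (Module.finBasis ℂ F)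
    (Matrix.toLin (Module.finBasis ℂ F) (Module.finBasis ℂ F) M)
    ((Module.finBasis ℂ F).equivFun.symm c)
  rw [LinearMap.toMatrix_toLin] at this
  rw [LinearEquiv.apply_symm_apply]
  refine this.symm.trans (congrArg _ ?_)
  exact (Module.finBasis ℂ F).equivFun.apply_symm_apply c

theorem end_frameVec (hx : x ∈ e.baseSet) (A : Module.End ℂ (E x))
    (c : Fin (Module.finrank ℂ F) → ℂ) :
    A (frameVec e x c) = frameVec e x (endMatrix F e x A *ᵥ c) := by
  have : A = endOfMatrix F e x (endMatrix F e x A) := by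
    refine LinearMap.ext fun v => ?_
    rw [endOfMatrix, endMatrix, Matrix.toLin_toMatrix]
    simp only [LinearMap.comp_apply, e.symmₗ_linearMapAt hx]
  rw [← endOfMatrix_frameVec hx, ← this]

theorem IsPosHermitian.gramMatrix_conjTranspose {h : SesqField E} (hh : IsPosHermitian h) (x : X) :
    (gramMatrix F e h x)ᴴ = gramMatrix F e h x := by
  ext i j
  exact (hh x).1 _ _

theorem IsPosHermitian.det_gramMatrix_ne_zero {h : SesqField E} (hh : IsPosHermitian h)
    (hx : x ∈ e.baseSet) : (gramMatrix F e h x).det ≠ 0 := fun h0 => by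
  obtain ⟨c, hc, hc0⟩ := Matrix.exists_mulVec_eq_zero_iff.mpr h0
  have h1 := (hh x).2 _ (frameVec_ne_zero hx hc)
  rw [apply_frameVec, hc0, dotProduct_zero] at h1
  exact lt_irrefl _ h1

theorem det_endMatrix_ne_zero (hx : x ∈ e.baseSet) (g : E x ≃ₗ[ℂ] E x) :
    (endMatrix F e x (g : Module.End ℂ (E x))).det ≠ 0 := fun h0 => by
  obtain ⟨c, hc, hc0⟩ := Matrix.exists_mulVec_eq_zero_iff.mpr h0
  have h1 := end_frameVec hx (g : Module.End ℂ (E x)) c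
  rw [hc0, frameVec_zero] at h1
  exact frameVec_ne_zero hx hc (g.map_eq_zero_iff.mp h1)

theorem gramMatrix_pullbackMetric (hx : x ∈ e.baseSet) (H : SesqField E)
    (g : ∀ x, E x ≃ₗ[ℂ] E x) :
    gramMatrix F e (pullbackMetric H g) x =
      (endMatrix F e x (g x : Module.End ℂ (E x)))ᴴ * gramMatrix F e H x *
        endMatrix F e x (g x : Module.End ℂ (E x)) := by
  set G := endMatrix F e x (g x : Module.End ℂ (E x)) with hG
  have key : ∀ a b, star a ⬝ᵥ (gramMatrix F e (pullbackMetric H g) x *ᵥ b) =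
      star a ⬝ᵥ ((Gᴴ * gramMatrix F e H x * G) *ᵥ b) := fun a b => by
    rw [← apply_frameVec]
    change H x ((g x : Module.End ℂ (E x)) (frameVec e x a))
      ((g x : Module.End ℂ (E x)) (frameVec e x b)) = _
    rw [end_frameVec hx, end_frameVec hx, apply_frameVec, ← Matrix.mulVec_mulVec,
      ← Matrix.mulVec_mulVec, star_mulVec, dotProduct_mulVec _ Gᴴ]
  ext i j
  have := key (Pi.single i 1) (Pi.single j 1)
  have hs : star (Pi.single i (1 : ℂ)) = (Pi.single i 1 : Fin (Module.finrank ℂ F) → ℂ) := by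
    rw [← Pi.single_star, star_one]
  simpa [hs] using this

/-- The basis of `T_x X` that is unitary for the Kähler form, in the preferred chart. -/
def KaehlerForm.chartBasis [FiniteDimensional ℂ V] (κ : KaehlerForm V X) (x : X) :
    Fin (Module.finrank ℂ V) → V :=
  fun j => κ.unitaryBasis x j

theorem metricCurvature_frameVec [FiniteDimensional ℂ V] (κ : KaehlerForm V X) (h : SesqField E)
    (x : X) (c : Fin (Module.finrank ℂ F) → ℂ) :
    metricCurvature F κ h x (frameVec (trivializationAt F E x) x c) =
      frameVec (trivializationAt F E x) x ((∑ j, curvatureForm (chernForm fun y =>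
        gramMatrix F (trivializationAt F E x) h ((chartAt V x).symm y)) (chartAt V x x)
          (κ.chartBasis x j) (Complex.I • κ.chartBasis x j)) *ᵥ c) :=
  endOfMatrix_frameVec (mem_baseSet_trivializationAt F E x) _ _

theorem gaugeCurvature_frameVec [FiniteDimensional ℂ V] (κ : KaehlerForm V X) (H : SesqField E)
    (g : EndField E) (x : X) (c : Fin (Module.finrank ℂ F) → ℂ) :
    gaugeCurvature F κ H g x (frameVec (trivializationAt F E x) x c) =
      frameVec (trivializationAt F E x) x ((∑ j, curvatureForm (gaugeForm
        (fun y => gramMatrix F (trivializationAt F E x) H ((chartAt V x).symm y))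
        (fun y => endMatrix F (trivializationAt F E x) ((chartAt V x).symm y)
          (g ((chartAt V x).symm y)))) (chartAt V x x)
          (κ.chartBasis x j) (Complex.I • κ.chartBasis x j)) *ᵥ c) :=
  endOfMatrix_frameVec (mem_baseSet_trivializationAt F E x) _ _

/-- The curvature depends only on the germ of the metric. This is needed because the matrix formula
for the pulled-back metric is available only over the base set of the trivialization. -/
theorem curvatureForm_chernForm_congr {r : ℕ} {h k : V → Matrix (Fin r) (Fin r) ℂ} {y : V}
    (hhk : h =ᶠ[𝓝 y] k) (u v : V) :
    curvatureForm (chernForm h) y u v = curvatureForm (chernForm k) y u v := by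
  have h1 : ∀ᶠ z in 𝓝 y, ∀ w, chernForm h z w = chernForm k z w := by
    filter_upwards [hhk.eventually_nhds] with z hz w
    rw [chernForm, chernForm, matDel_congr hz, hz.self_of_nhds]
  have h2 : ∀ w, (fun z => chernForm h z w) =ᶠ[𝓝 y] fun z => chernForm k z w :=
    fun w => h1.mono fun z hz => hz w
  simp only [curvatureForm, matD_congr (h2 _), h1.self_of_nhds]

/-- The contracted curvature of the connection defined by `H` and `g` is conjugate by `g` to that of
the metric `H(g _, g _)`. -/
theorem gaugeCurvature_apply [FiniteDimensional ℂ V] (κ : KaehlerForm V X) {H : SesqField E}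
    {g : ∀ x, E x ≃ₗ[ℂ] E x} (hHpos : IsPosHermitian H) (x : X)
    (hH : MatContDiffAt 2 (fun y => gramMatrix F (trivializationAt F E x) H ((chartAt V x).symm y))
      (chartAt V x x))
    (hg : MatContDiffAt 2 (fun y => endMatrix F (trivializationAt F E x) ((chartAt V x).symm y)
      (g ((chartAt V x).symm y) : Module.End ℂ _)) (chartAt V x x)) (v : E x) :
    gaugeCurvature F κ H (fun y => (g y : Module.End ℂ (E y))) x (g x v) =
      g x (metricCurvature F κ (pullbackMetric H g) x v) := by
  have hx := mem_baseSet_trivializationAt F E x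
  have hev := eventually_chartAt_symm_mem (V := V) (trivializationAt F E x).open_baseSet hx
  obtain ⟨c, rfl⟩ := exists_frameVec_eq hx v
  have hgx : ∀ c, g x (frameVec (trivializationAt F E x) x c) =
    (g x : Module.End ℂ (E x)) (frameVec (trivializationAt F E x) x c) := fun _ => rfl
  have h1 := curvatureForm_gaugeForm_mul hH hg
    (hHpos.det_gramMatrix_ne_zero hev.self_of_nhds) (det_endMatrix_ne_zero hev.self_of_nhds _)
  have h2 : (fun y => gramMatrix F (trivializationAt F E x) (pullbackMetric H g)
      ((chartAt V x).symm y)) =ᶠ[𝓝 (chartAt V x x)] _ :=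
    hev.mono fun y hy => gramMatrix_pullbackMetric hy H g
  rw [metricCurvature_frameVec, hgx, hgx, end_frameVec hx (g x : Module.End ℂ (E x)),
    end_frameVec hx (g x : Module.End ℂ (E x)),
    gaugeCurvature_frameVec, Matrix.mulVec_mulVec, Matrix.mulVec_mulVec]
  congr 2
  rw [Finset.sum_mul, Finset.mul_sum]
  refine Finset.sum_congr rfl fun j _ => ?_
  rw [curvatureForm_chernForm_congr h2]
  have h3 := h1 (κ.chartBasis x j) (Complex.I • κ.chartBasis x j)
  have h4 : endMatrix F (trivializationAt F E x) ((chartAt V x).symm (chartAt V x x))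
      (g ((chartAt V x).symm (chartAt V x x)) : Module.End ℂ _) =
      endMatrix F (trivializationAt F E x) x (g x : Module.End ℂ _) := by
    rw [(chartAt V x).left_inv (mem_chart_source V x)]
  simp only [h4] at h3
  exact h3

/-! ### Smooth families -/

theorem ContMDiffAt.contDiffAt_chart {f : X → ℂ} {x : X}
    (hf : ContMDiffAt 𝓘(ℝ, V) 𝓘(ℝ, ℂ) ∞ f x) :
    ContDiffAt ℝ ∞ (fun y => f ((chartAt V x).symm y)) (chartAt V x x) := by
  have := (contMDiffAt_iff.mp hf).2
  simp only [Function.comp_def, contDiffWithinAt_univ, mfld_simps] at this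
  exact this

theorem contMDiffAt_slice {f : ℝ × X → ℂ} {s : Set X} (hs : IsOpen s)
    (hf : ContMDiffOn (𝓘(ℝ, ℝ).prod 𝓘(ℝ, V)) 𝓘(ℝ, ℂ) ∞ f (Ici 0 ×ˢ s)) {t : ℝ} (ht : 0 ≤ t)
    {x : X} (hx : x ∈ s) : ContMDiffAt 𝓘(ℝ, V) 𝓘(ℝ, ℂ) ∞ (fun y => f (t, y)) x := by
  have : ContMDiffOn 𝓘(ℝ, V) 𝓘(ℝ, ℂ) ∞ (fun y => f (t, y)) s :=
    hf.comp (contMDiff_const.prodMk contMDiff_id).contMDiffOn fun y hy => ⟨ht, hy⟩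
  exact this.contMDiffAt (hs.mem_nhds hx)

theorem differentiableOn_time {f : ℝ × X → ℂ} {s : Set X}
    (hf : ContMDiffOn (𝓘(ℝ, ℝ).prod 𝓘(ℝ, V)) 𝓘(ℝ, ℂ) ∞ f (Ici 0 ×ˢ s))
    {x : X} (hx : x ∈ s) : DifferentiableOn ℝ (fun t => f (t, x)) (Ici 0) := by
  have : ContMDiffOn 𝓘(ℝ, ℝ) 𝓘(ℝ, ℂ) ∞ (fun t => f (t, x)) (Ici 0) :=
    hf.comp (contMDiff_id.prodMk contMDiff_const).contMDiffOn fun y hy => ⟨hy, hx⟩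
  exact (contMDiffOn_iff_contDiffOn.mp this).differentiableOn (by simp)

end Frames

/-! ### Comparison of subsolutions and supersolutions -/

section SesqField

variable {X : Type*} {E : X → Type*} [∀ x, AddCommGroup (E x)] [∀ x, Module ℂ (E x)]

/-- The field of forms is positive definite on the fibre at `x`. -/
def IsPosAt (P : SesqField E) (x : X) : Prop := ∀ v : E x, v ≠ 0 → 0 < (P x v v).re

theorem IsPosHermitian.apply_self_eq {h : SesqField E} (hh : IsPosHermitian h) {x : X} (v : E x) :
    h x v v = ((h x v v).re : ℂ) :=
  (Complex.conj_eq_iff_re.mp ((hh x).1 v v)).symm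

theorem IsPosHermitian.re_nonneg {h : SesqField E} (hh : IsPosHermitian h) {x : X} (v : E x) :
    0 ≤ (h x v v).re := by
  by_cases hv : v = 0
  · simp [hv]
  · exact ((hh x).2 v hv).le

theorem re_smul_sub_apply (ρ : ℝ) (h k : SesqField E) {x : X} (v : E x) :
    (((ρ : ℂ) • k x - h x) v v).re = ρ * (k x v v).re - (h x v v).re := by
  simp

end SesqField

/-! ### Compactness and positivity of families of forms -/

section Comparison

open Matrix

variable {V : Type*} [NormedAddCommGroup V] [NormedSpace ℂ V]
  {X : Type*} [TopologicalSpace X] [ChartedSpace V X]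
  {F : Type*} [NormedAddCommGroup F] [NormedSpace ℂ F] [FiniteDimensional ℂ F]
  {E : X → Type*} [∀ x, AddCommGroup (E x)] [∀ x, Module ℂ (E x)] [∀ x, TopologicalSpace (E x)]
  [TopologicalSpace (TotalSpace F E)] [FiberBundle F E] [VectorBundle ℂ F E]

variable (V F) in
/-- A family `h t`, `t ∈ [0, ∞)`, of Hermitian metrics, continuous in `(t, x)` and of class `C^2`
in `x`. -/
structure IsRegularMetricFamily (h : ℝ → SesqField E) : Prop where
  posHermitian : ∀ t, 0 ≤ t → IsPosHermitian (h t)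
  continuousOn : ∀ (e : Trivialization F (π F E)) [MemTrivializationAtlas e], ∀ i j,
    ContinuousOn (fun p : ℝ × X => gramMatrix F e (h p.1) p.2 i j) (Ici 0 ×ˢ e.baseSet)
  contDiffAt : ∀ t, 0 ≤ t → ∀ x, MatContDiffAt 2
    (fun y => gramMatrix F (trivializationAt F E x) (h t) ((chartAt V x).symm y)) (chartAt V x x)

theorem IsHermitianMetricFamily.isRegularMetricFamily {h : ℝ → SesqField E}
    (hh : IsHermitianMetricFamily V F h) : IsRegularMetricFamily V F h where
  posHermitian := hh.posHermitian
  continuousOn e _ i j := (hh.smooth e i j).continuousOn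
  contDiffAt t ht x i j := by
    have := ContMDiffAt.contDiffAt_chart (contMDiffAt_slice
      (trivializationAt F E x).open_baseSet (hh.smooth (trivializationAt F E x) i j) ht
      (mem_baseSet_trivializationAt F E x))
    exact this.of_le (WithTop.coe_le_coe.mpr le_top)

/-- The quadratic form of a continuous family of forms is continuous in a frame. -/
theorem continuousOn_apply_frameVec {P : ℝ → SesqField E} (e : Trivialization F (π F E))
    [MemTrivializationAtlas e]
    (hP : ∀ i j, ContinuousOn (fun p : ℝ × X => gramMatrix F e (P p.1) p.2 i j)
      (Ici 0 ×ˢ e.baseSet)) :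
    ContinuousOn (fun q : (ℝ × X) × (Fin (Module.finrank ℂ F) → ℂ) =>
      (P q.1.1 q.1.2 (frameVec e q.1.2 q.2) (frameVec e q.1.2 q.2)).re)
      ((Ici 0 ×ˢ e.baseSet) ×ˢ univ) := by
  simp only [apply_frameVec, dotProduct, mulVec]
  refine Complex.continuous_re.comp_continuousOn (continuousOn_finsetSum _ fun i _ => ?_)
  refine ContinuousOn.mul (by fun_prop)
    (continuousOn_finsetSum _ fun j _ => ContinuousOn.mul ?_ (by fun_prop))
  exact (hP i j).comp continuousOn_fst fun q hq => hq.1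

/-- By homogeneity, positivity can be tested on a compact set of coordinate vectors that is the same
for every fibre over the base set. -/
theorem isPosAt_iff_sphere {P : SesqField E} {e : Trivialization F (π F E)}
    [MemTrivializationAtlas e] {x : X} (hx : x ∈ e.baseSet) :
    IsPosAt P x ↔ ∀ c ∈ Metric.sphere (0 : Fin (Module.finrank ℂ F) → ℂ) 1,
      0 < (P x (frameVec e x c) (frameVec e x c)).re := by
  constructor
  · intro h c hc
    refine h _ (frameVec_ne_zero hx ?_)
    rintro rfl
    simp at hc
  · intro h v hv
    obtain ⟨c, rfl⟩ := exists_frameVec_eq hx v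
    have hc : c ≠ 0 := by
      rintro rfl
      exact hv frameVec_zero
    have hn : 0 < ‖c‖ := norm_pos_iff.mpr hc
    have h1 := h (((‖c‖⁻¹ : ℝ) : ℂ) • c) (by
      rw [mem_sphere_zero_iff_norm, norm_smul, Complex.norm_real, norm_inv, norm_norm,
        inv_mul_cancel₀ hn.ne'])
    simp only [apply_frameVec] at h1 ⊢
    rw [star_smul, Matrix.mulVec_smul, dotProduct_smul, smul_dotProduct, Complex.star_def,
      Complex.conj_ofReal, smul_eq_mul, smul_eq_mul, Complex.re_ofReal_mul,
      Complex.re_ofReal_mul] at h1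
    have h2 : 0 < ‖c‖⁻¹ := inv_pos.mpr hn
    exact pos_of_mul_pos_right (pos_of_mul_pos_right h1 h2.le) h2.le

variable (F) in
/-- Positivity of a continuous family of forms is an open condition. -/
theorem IsPosAt.eventually {P : ℝ → SesqField E}
    (hP : ∀ (e : Trivialization F (π F E)) [MemTrivializationAtlas e], ∀ i j,
      ContinuousOn (fun p : ℝ × X => gramMatrix F e (P p.1) p.2 i j) (Ici 0 ×ˢ e.baseSet))
    {p : ℝ × X} (hp : 0 ≤ p.1) (h : IsPosAt (P p.1) p.2) :
    ∀ᶠ q in 𝓝[Ici 0 ×ˢ univ] p, IsPosAt (P q.1) q.2 := by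
  set e := trivializationAt F E p.2
  have hx : p.2 ∈ e.baseSet := mem_baseSet_trivializationAt F E p.2
  have hnhds : 𝓝[Ici 0 ×ˢ univ] p = 𝓝[Ici 0 ×ˢ e.baseSet] p := by
    have : Ici 0 ×ˢ e.baseSet = (Ici 0 ×ˢ univ) ∩ ((univ : Set ℝ) ×ˢ e.baseSet) := by
      ext q
      simp
    rw [this, inter_comm]
    exact (nhdsWithin_inter_of_mem (nhdsWithin_le_nhds
      ((isOpen_univ.prod e.open_baseSet).mem_nhds ⟨trivial, hx⟩))).symm
  rw [hnhds]
  have hc := continuousOn_apply_frameVec e (fun i j => hP e i j)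
  have key : ∀ c ∈ Metric.sphere (0 : Fin (Module.finrank ℂ F) → ℂ) 1,
      ∀ᶠ q : (ℝ × X) × (Fin (Module.finrank ℂ F) → ℂ) in 𝓝[Ici 0 ×ˢ e.baseSet] p ×ˢ 𝓝 c,
        0 < (P q.1.1 q.1.2 (frameVec e q.1.2 q.2) (frameVec e q.1.2 q.2)).re := fun c hcs => by
    have h1 := hc (p, c) ⟨⟨hp, hx⟩, trivial⟩
    rw [ContinuousWithinAt, nhdsWithin_prod_eq, nhdsWithin_univ] at h1
    exact h1.eventually_const_lt ((isPosAt_iff_sphere hx).mp h c hcs)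
  -- Tube lemma: compactness of the sphere makes the neighbourhood of `p` uniform in the vector `c`.
  have h2 := (isCompact_sphere (0 : Fin (Module.finrank ℂ F) → ℂ) 1).mem_prod_nhdsSet_of_forall key
  have h3 : ∀ᶠ q : ℝ × X in 𝓝[Ici 0 ×ˢ e.baseSet] p, ∀ᶠ c in 𝓝ˢ (Metric.sphere 0 1),
      0 < (P q.1 q.2 (frameVec e q.2 c) (frameVec e q.2 c)).re := Eventually.curry h2
  filter_upwards [h3, self_mem_nhdsWithin] with q hq hqx
  exact (isPosAt_iff_sphere hqx.2).mpr hq.self_of_nhdsSet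

variable (F) in
-- Compactness provides a first time at which positivity fails.
theorem isCompact_not_isPosAt [CompactSpace X] {P : ℝ → SesqField E}
    (hP : ∀ (e : Trivialization F (π F E)) [MemTrivializationAtlas e], ∀ i j,
      ContinuousOn (fun p : ℝ × X => gramMatrix F e (P p.1) p.2 i j) (Ici 0 ×ˢ e.baseSet)) (t : ℝ) :
    IsCompact {p : ℝ × X | p ∈ Icc 0 t ×ˢ univ ∧ ¬ IsPosAt (P p.1) p.2} := by
  refine (isCompact_Icc.prod isCompact_univ).of_isClosed_subset ?_ fun p hp => hp.1
  rw [← isOpen_compl_iff, isOpen_iff_mem_nhds]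
  intro p hp
  by_cases hpI : p.1 ∈ Icc 0 t
  · have hpos : IsPosAt (P p.1) p.2 := by
      by_contra hn
      exact hp ⟨⟨hpI, trivial⟩, hn⟩
    have := IsPosAt.eventually F hP hpI.1 hpos
    rw [eventually_nhdsWithin_iff] at this
    filter_upwards [this] with q hq hqS
    exact hqS.2 (hq ⟨hqS.1.1.1, trivial⟩)
  · have : ∀ᶠ q : ℝ × X in 𝓝 p, q.1 ∈ (Icc 0 t)ᶜ :=
      continuous_fst.continuousAt.eventually_mem (isClosed_Icc.isOpen_compl.mem_nhds hpI)
    filter_upwards [this] with q hq hqS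
    exact hq hqS.1.1

theorem gramMatrix_smul_sub (e : Trivialization F (π F E)) [MemTrivializationAtlas e] (ρ : ℂ)
    (h k : SesqField E) (x : X) (i j : Fin (Module.finrank ℂ F)) :
    gramMatrix F e (fun x => ρ • k x - h x) x i j =
      ρ * gramMatrix F e k x i j - gramMatrix F e h x i j := rfl

variable {h k : ℝ → SesqField E}

theorem continuousOn_gramMatrix_smul_sub (hh : IsRegularMetricFamily V F h)
    (hk : IsRegularMetricFamily V F k) {ρ : ℝ → ℝ} (hρ : ContinuousOn ρ (Ici 0))
    (e : Trivialization F (π F E)) [MemTrivializationAtlas e] (i j : Fin (Module.finrank ℂ F)) :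
    ContinuousOn
      (fun p : ℝ × X => gramMatrix F e (fun x => (ρ p.1 : ℂ) • k p.1 x - h p.1 x) p.2 i j)
      (Ici 0 ×ˢ e.baseSet) := by
  simp only [gramMatrix_smul_sub]
  refine ContinuousOn.sub (ContinuousOn.mul ?_ (hk.continuousOn e i j)) (hh.continuousOn e i j)
  exact Complex.continuous_ofReal.comp_continuousOn
    (hρ.comp continuousOn_fst fun p hp => hp.1)

variable (V F) in
/-- Two metrics on a bundle over a compact space are comparable. -/
theorem exists_const_initial [CompactSpace X] (hh : IsRegularMetricFamily V F h)
    (hk : IsRegularMetricFamily V F k) :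
    ∃ C : ℝ, 0 < C ∧ ∀ x, ∀ v : E x, v ≠ 0 → (h 0 x v v).re < C * (k 0 x v v).re := by
  let P : ℝ → ℝ → SesqField E := fun C t x => (C : ℂ) • k t x - h t x
  have hPre : ∀ C t x (v : E x), (P C t x v v).re = C * (k t x v v).re - (h t x v v).re :=
    fun C t x v => re_smul_sub_apply _ _ _ v
  have hmono : ∀ {C C' : ℝ} {x}, C ≤ C' → IsPosAt (P C 0) x → IsPosAt (P C' 0) x :=
    fun {C C' x} hCC hC v hv => by
      have h1 := hC v hv
      rw [hPre] at h1 ⊢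
      have := mul_le_mul_of_nonneg_right hCC ((hk.posHermitian 0 le_rfl).re_nonneg v)
      linarith
  have hopen : ∀ C x, IsPosAt (P C 0) x → ∀ᶠ y in 𝓝 x, IsPosAt (P C 0) y := fun C x hx => by
    have h1 := IsPosAt.eventually F (P := P C) (p := (0, x))
      (fun e _ i j => continuousOn_gramMatrix_smul_sub hh hk continuousOn_const e i j) le_rfl hx
    have h2 : Tendsto (fun y : X => ((0 : ℝ), y)) (𝓝 x) (𝓝[Ici 0 ×ˢ univ] (0, x)) :=
      tendsto_nhdsWithin_iff.mpr ⟨(Continuous.prodMk_right (0 : ℝ)).tendsto x,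
        Eventually.of_forall fun y => ⟨self_mem_Ici, trivial⟩⟩
    exact h2.eventually h1
  have hpt : ∀ x, ∃ C, 0 < C ∧ IsPosAt (P C 0) x := fun x => by
    have hx := mem_baseSet_trivializationAt F E x
    have hcont : ∀ {l : ℝ → SesqField E}, IsRegularMetricFamily V F l →
        ContinuousOn (fun c => (l 0 x (frameVec (trivializationAt F E x) x c)
          (frameVec (trivializationAt F E x) x c)).re)
          (Metric.sphere (0 : Fin (Module.finrank ℂ F) → ℂ) 1) := fun {l} hl => by
      have := continuousOn_apply_frameVec (trivializationAt F E x)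
        (fun i j => hl.continuousOn (trivializationAt F E x) i j)
      exact this.comp (f := fun c => (((0 : ℝ), x), c)) (by fun_prop)
        fun c _ => ⟨⟨self_mem_Ici, hx⟩, trivial⟩
    have hkpos : ∀ c ∈ Metric.sphere (0 : Fin (Module.finrank ℂ F) → ℂ) 1,
        0 < (k 0 x (frameVec (trivializationAt F E x) x c)
          (frameVec (trivializationAt F E x) x c)).re :=
      (isPosAt_iff_sphere hx).mp (hk.posHermitian 0 le_rfl x).2
    obtain ⟨B, hB⟩ := (isCompact_sphere (0 : Fin (Module.finrank ℂ F) → ℂ) 1).bddAbove_image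
      ((hcont hh).div (hcont hk) fun c hc => (hkpos c hc).ne')
    -- `B` bounds the ratio `h/k` on the sphere; the maximum with `0` gives a positive constant and
    -- the `+ 1` a strict inequality.
    refine ⟨max B 0 + 1, by positivity, (isPosAt_iff_sphere hx).mpr fun c hc => ?_⟩
    have h1 := hB (mem_image_of_mem _ hc)
    rw [Pi.div_apply, div_le_iff₀ (hkpos c hc)] at h1
    have h2 := mul_le_mul_of_nonneg_right (le_max_left B 0) (hkpos c hc).le
    rw [hPre]
    linarith [hkpos c hc]
  choose C hC0 hC using hpt
  obtain ⟨s, hs⟩ := isCompact_univ.elim_nhds_subcover (fun x => {y | IsPosAt (P (C x) 0) y})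
    (fun x _ => hopen (C x) x (hC x))
  -- The sum of the positive local constants dominates each of them; the `+ 1` keeps it positive
  -- even if the subcover is empty.
  refine ⟨∑ x ∈ s, C x + 1, by
    have := Finset.sum_nonneg fun x (_ : x ∈ s) => (hC0 x).le
    linarith, fun x v hv => ?_⟩
  obtain ⟨y, hy, hxy⟩ := mem_iUnion₂.mp (hs.2 (mem_univ x))
  have hle : C y ≤ ∑ x ∈ s, C x + 1 := by
    have := Finset.single_le_sum (fun x _ => (hC0 x).le) hy
    linarith
  have := hmono hle hxy v hv
  rw [hPre] at this
  linarith

/-! ### The maximum principle for the flow -/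

variable [FiniteDimensional ℂ V]

/-- Splits the right-hand side of the flow into contributions of single complex lines, to which the
local touching inequality applies, and a term in `λ` that sees only `h(v, v)`. -/
theorem re_apply_flow_frameVec (κ : KaehlerForm V X) (lam : ℂ) (h : SesqField E) (x : X)
    (c : Fin (Module.finrank ℂ F) → ℂ) :
    (h x (frameVec (trivializationAt F E x) x c) ((-(2 * Complex.I) •
      (metricCurvature F κ h x - lam • 1)) (frameVec (trivializationAt F E x) x c))).re =
    ∑ j, (star c ⬝ᵥ (gramMatrix F (trivializationAt F E x) h x *ᵥ ((-(2 * Complex.I) •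
      curvatureForm (chernForm fun y => gramMatrix F (trivializationAt F E x) h
        ((chartAt V x).symm y)) (chartAt V x x) (κ.chartBasis x j)
          (Complex.I • κ.chartBasis x j)) *ᵥ c))).re +
      (2 * Complex.I * lam * h x (frameVec (trivializationAt F E x) x c)
        (frameVec (trivializationAt F E x) x c)).re := by
  rw [LinearMap.smul_apply, LinearMap.sub_apply, LinearMap.smul_apply, Module.End.one_apply,
    metricCurvature_frameVec, map_smul, map_sub, map_smul]
  have : ∀ d, h x (frameVec (trivializationAt F E x) x c) (frameVec (trivializationAt F E x) x d) =
    star c ⬝ᵥ (gramMatrix F (trivializationAt F E x) h x *ᵥ d) := fun d => apply_frameVec h c d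
  rw [this, this]
  simp only [Matrix.smul_mulVec, Matrix.mulVec_smul, dotProduct_smul]
  rw [← Complex.re_sum, ← Finset.smul_sum, ← dotProduct_sum, ← Matrix.mulVec_sum,
    ← Matrix.sum_mulVec, ← Complex.add_re]
  congr 1
  simp only [smul_eq_mul]
  ring

/-- If `h ≤ ρ k`, with equality on the vector `v`, then the right hand sides of the flow equation
for `h` and `k` are related on `v`. -/
theorem re_apply_flow_le_of_touching (κ : KaehlerForm V X) (lam : ℂ) {h k : SesqField E}
    (hh : IsPosHermitian h) (hk : IsPosHermitian k) {x : X}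
    (hh2 : MatContDiffAt 2 (fun y => gramMatrix F (trivializationAt F E x) h ((chartAt V x).symm y))
      (chartAt V x x))
    (hk2 : MatContDiffAt 2 (fun y => gramMatrix F (trivializationAt F E x) k ((chartAt V x).symm y))
      (chartAt V x x)) {ρ : ℝ}
    (hle : ∀ x, ∀ v : E x, (h x v v).re ≤ ρ * (k x v v).re) {v : E x}
    (heq : (h x v v).re = ρ * (k x v v).re) :
    (h x v ((-(2 * Complex.I) • (metricCurvature F κ h x - lam • 1)) v)).re ≤
      ρ * (k x v ((-(2 * Complex.I) • (metricCurvature F κ k x - lam • 1)) v)).re := by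
  have hx := mem_baseSet_trivializationAt F E x
  have hev := eventually_chartAt_symm_mem (V := V) (trivializationAt F E x).open_baseSet hx
  obtain ⟨c, rfl⟩ := exists_frameVec_eq hx v
  have hxx := (chartAt V x).left_inv (mem_chart_source V x)
  rw [re_apply_flow_frameVec, re_apply_flow_frameVec, mul_add, Finset.mul_sum]
  refine add_le_add (Finset.sum_le_sum fun j _ => ?_) (le_of_eq ?_)
  · have := curvatureForm_le_of_touching hh2 hk2
      (Eventually.of_forall fun y => hh.gramMatrix_conjTranspose _)
      (Eventually.of_forall fun y => hk.gramMatrix_conjTranspose _)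
      (hh.det_gramMatrix_ne_zero hev.self_of_nhds) (hk.det_gramMatrix_ne_zero hev.self_of_nhds)
      (fun d => by rw [← apply_frameVec]; exact hh.re_nonneg _) (ρ := ρ) (v := c)
      (Eventually.of_forall fun y d => by
        rw [← apply_frameVec, ← apply_frameVec]
        exact hle _ _)
      (by simpa only [hxx, ← apply_frameVec] using heq) (κ.chartBasis x j)
    simpa only [hxx] using this
  -- The terms in `λ` agree because `h(v, v)` and `ρ k(v, v)` are the same real number.
  · rw [hh.apply_self_eq, heq, hk.apply_self_eq (x := x) (frameVec _ _ _), Complex.ofReal_re]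
    push_cast
    rw [← Complex.re_ofReal_mul]
    congr 1
    ring

variable (F) in
/-- `h` satisfies `∂_t h ≤ h(_, -2 i (ΛF - lam) _) + a h`, as quadratic forms. -/
def IsSubsolution (κ : KaehlerForm V X) (lam : ℂ) (a : ℝ → ℝ) (h : ℝ → SesqField E) : Prop :=
  ∀ t, 0 ≤ t → ∀ x, ∀ v : E x, ∃ d : ℝ,
    HasDerivWithinAt (fun τ => (h τ x v v).re) d (Ici 0) t ∧
    d ≤ (h t x v ((-(2 * Complex.I) • (metricCurvature F κ (h t) x - lam • 1)) v)).re
      + a t * (h t x v v).re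

variable (F) in
/-- `h` satisfies `∂_t h ≥ h(_, -2 i (ΛF - lam) _) - a h`, as quadratic forms. -/
def IsSupersolution (κ : KaehlerForm V X) (lam : ℂ) (a : ℝ → ℝ) (h : ℝ → SesqField E) : Prop :=
  ∀ t, 0 ≤ t → ∀ x, ∀ v : E x, ∃ d : ℝ,
    HasDerivWithinAt (fun τ => (h τ x v v).re) d (Ici 0) t ∧
    (h t x v ((-(2 * Complex.I) • (metricCurvature F κ (h t) x - lam • 1)) v)).re
      - a t * (h t x v v).re ≤ d

/-- The maximum principle, with a strict differential inequality. -/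
theorem comparison_of_strict [CompactSpace X] (κ : KaehlerForm V X) (lam : ℂ) {a b : ℝ → ℝ}
    (hh : IsRegularMetricFamily V F h) (hk : IsRegularMetricFamily V F k)
    (hsub : IsSubsolution F κ lam a h) (hsup : IsSupersolution F κ lam b k)
    {ρ ρ' : ℝ → ℝ} (hρ : ContinuousOn ρ (Ici 0)) (hρ' : ∀ t, 0 < t → HasDerivAt ρ (ρ' t) t)
    (hρpos : ∀ t, 0 ≤ t → 0 < ρ t)
    (hstrict : ∀ t, 0 < t → (a t + b t) * ρ t < ρ' t)
    (h0 : ∀ x, ∀ v : E x, v ≠ 0 → (h 0 x v v).re < ρ 0 * (k 0 x v v).re)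
    {t : ℝ} (ht : 0 ≤ t) {x : X} {v : E x} (hv : v ≠ 0) :
    (h t x v v).re < ρ t * (k t x v v).re := by
  let P : ℝ → SesqField E := fun t x => (ρ t : ℂ) • k t x - h t x
  have hPre : ∀ t x (v : E x), (P t x v v).re = ρ t * (k t x v v).re - (h t x v v).re :=
    fun t x v => re_smul_sub_apply _ _ _ v
  have hPc := fun (e : Trivialization F (π F E)) [MemTrivializationAtlas e] i j =>
    show ContinuousOn (fun p : ℝ × X => gramMatrix F e (P p.1) p.2 i j) (Ici 0 ×ˢ e.baseSet) from
      continuousOn_gramMatrix_smul_sub hh hk hρ e i j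
  suffices hpos : IsPosAt (P t) x by
    have := hpos v hv
    rw [hPre] at this
    linarith
  by_contra hbad
  have hScompact := isCompact_not_isPosAt F hPc t
  -- A bad point with the least time coordinate.
  obtain ⟨⟨t₀, x₀⟩, ⟨⟨⟨ht₀, ht₀t⟩, -⟩, hbad₀⟩, hmin⟩ := hScompact.exists_isMinOn
    ⟨(t, x), ⟨⟨⟨ht, le_rfl⟩, trivial⟩, hbad⟩⟩ continuous_fst.continuousOn
  simp only at ht₀ ht₀t hbad₀
  -- Positivity of `t₀` turns the one-sided derivatives on `[0, ∞)` into genuine ones and leaves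
  -- earlier times to compare with.
  have ht₀pos : 0 < t₀ := by
    refine lt_of_le_of_ne ht₀ ?_
    rintro rfl
    refine hbad₀ fun v hv => ?_
    rw [hPre]
    linarith [h0 x₀ v hv]
  have hbefore : ∀ τ, 0 ≤ τ → τ < t₀ → ∀ x, IsPosAt (P τ) x := fun τ hτ hτt x => by
    by_contra hn
    have : t₀ ≤ τ := hmin (a := (τ, x)) ⟨⟨⟨hτ, hτt.le.trans ht₀t⟩, trivial⟩, hn⟩
    linarith
  have hderiv : ∀ x (v : E x), ∃ dh dk : ℝ,
      HasDerivAt (fun τ => (P τ x v v).re)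
        (ρ' t₀ * (k t₀ x v v).re + ρ t₀ * dk - dh) t₀ ∧
      dh ≤ (h t₀ x v ((-(2 * Complex.I) • (metricCurvature F κ (h t₀) x - lam • 1)) v)).re
        + a t₀ * (h t₀ x v v).re ∧
      (k t₀ x v ((-(2 * Complex.I) • (metricCurvature F κ (k t₀) x - lam • 1)) v)).re
        - b t₀ * (k t₀ x v v).re ≤ dk := fun x v => by
    obtain ⟨dh, hdh, hdh'⟩ := hsub t₀ ht₀ x v
    obtain ⟨dk, hdk, hdk'⟩ := hsup t₀ ht₀ x v
    refine ⟨dh, dk, ?_, hdh', hdk'⟩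
    simp only [hPre]
    exact ((hρ' t₀ ht₀pos).mul (hdk.hasDerivAt (Ici_mem_nhds ht₀pos))).sub
      (hdh.hasDerivAt (Ici_mem_nhds ht₀pos))
  have hleft : ∀ x (v : E x), ∀ᶠ τ in 𝓝[<] t₀, 0 ≤ (P τ x v v).re := fun x v => by
    filter_upwards [self_mem_nhdsWithin,
      nhdsWithin_le_nhds (eventually_gt_nhds ht₀pos)] with τ h1 h2
    by_cases hv : v = 0
    · simp [hv]
    · exact (hbefore τ (le_of_lt h2) h1 x v hv).le
  -- Nonnegativity on all of `X` passes to the limit `τ ↑ t₀`; it makes the zero at `(x₀, v₀)` a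
  -- spatial minimum.
  have hnonneg : ∀ x (v : E x), 0 ≤ (P t₀ x v v).re := fun x v => by
    obtain ⟨dh, dk, hd, -⟩ := hderiv x v
    exact ge_of_tendsto (hd.continuousAt.tendsto.mono_left nhdsWithin_le_nhds) (hleft x v)
  obtain ⟨v₀, hv₀, hv₀'⟩ : ∃ v : E x₀, v ≠ 0 ∧ (P t₀ x₀ v v).re ≤ 0 := by
    simpa [IsPosAt] using hbad₀
  have hzero : (P t₀ x₀ v₀ v₀).re = 0 := le_antisymm hv₀' (hnonneg x₀ v₀)
  obtain ⟨dh, dk, hd, hdh, hdk⟩ := hderiv x₀ v₀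
  -- `P(v₀, v₀)` is nonnegative before `t₀` and zero at `t₀`, so its left difference quotients are
  -- nonpositive.
  have hd0 : ρ' t₀ * (k t₀ x₀ v₀ v₀).re + ρ t₀ * dk - dh ≤ 0 := by
    have hslope : Tendsto (slope (fun τ => (P τ x₀ v₀ v₀).re) t₀) (𝓝[<] t₀) (𝓝 _) :=
      (hasDerivAt_iff_tendsto_slope.mp hd).mono_left (nhdsWithin_mono _ fun τ hτ => ne_of_lt hτ)
    refine le_of_tendsto hslope ?_
    filter_upwards [self_mem_nhdsWithin, hleft x₀ v₀] with τ h1 h2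
    rw [slope_def_field, hzero, sub_zero]
    exact div_nonpos_of_nonneg_of_nonpos h2 (sub_nonpos.mpr (le_of_lt h1))
  rw [hPre] at hzero
  have hcurv := re_apply_flow_le_of_touching κ lam (hh.posHermitian t₀ ht₀)
    (hk.posHermitian t₀ ht₀) (hh.contDiffAt t₀ ht₀ x₀) (hk.contDiffAt t₀ ht₀ x₀) (ρ := ρ t₀)
    (fun x v => by
      have := hnonneg x v
      rw [hPre] at this
      linarith) (v := v₀) (by linarith)
  have hkpos : 0 < (k t₀ x₀ v₀ v₀).re := (hk.posHermitian t₀ ht₀ x₀).2 v₀ hv₀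
  have h1 := mul_lt_mul_of_pos_right (hstrict t₀ ht₀pos) hkpos
  have h2 := mul_le_mul_of_nonneg_left hdk (hρpos t₀ ht₀).le
  have h3 : a t₀ * (h t₀ x₀ v₀ v₀).re = a t₀ * (ρ t₀ * (k t₀ x₀ v₀ v₀).re) := by
    rw [← sub_eq_zero.mp hzero]
  rw [mul_sub] at h2
  linarith

/-- A subsolution is bounded by a multiple of a supersolution. -/
theorem exists_comparison [CompactSpace X] (κ : KaehlerForm V X) (lam : ℂ) {a b R : ℝ → ℝ}
    (hh : IsRegularMetricFamily V F h) (hk : IsRegularMetricFamily V F k)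
    (hsub : IsSubsolution F κ lam a h) (hsup : IsSupersolution F κ lam b k)
    (hR : ContinuousOn R (Ici 0)) (hR' : ∀ t, 0 < t → HasDerivAt R (a t + b t) t) :
    ∃ C : ℝ, 0 < C ∧ ∀ t, 0 ≤ t → ∀ x, ∀ v : E x,
      (h t x v v).re ≤ C * Real.exp (R t) * (k t x v v).re := by
  obtain ⟨C, hC, hC'⟩ := exists_const_initial V F hh hk
  have hCR : 0 < C * Real.exp (-R 0) := by positivity
  refine ⟨C * Real.exp (-R 0), hCR, fun t ht x v => ?_⟩
  by_cases hv : v = 0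
  · simp [hv]
  -- The extra `εt` in the exponent makes the differential inequality strict, and the factor `exp(-R
  -- 0)` normalises `ρ(0) = C`. Then `ε → 0`.
  have key : ∀ ε : ℝ, 0 < ε → (h t x v v).re <
      C * Real.exp (-R 0) * Real.exp (R t + ε * t) * (k t x v v).re := fun ε hε => by
    refine comparison_of_strict (ρ := fun t => C * Real.exp (-R 0) * Real.exp (R t + ε * t))
      (ρ' := fun t => C * Real.exp (-R 0) * (Real.exp (R t + ε * t) * (a t + b t + ε)))
      κ lam hh hk hsub hsup ?_ ?_ ?_ ?_ ?_ ht hv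
    · exact continuousOn_const.mul (Real.continuous_exp.comp_continuousOn
        (hR.add (by fun_prop)))
    · intro t ht
      have := ((hR' t ht).add ((hasDerivAt_id t).const_mul ε)).exp.const_mul (C * Real.exp (-R 0))
      simpa using this
    · intro t _
      positivity
    · intro t _
      have : 0 < C * Real.exp (-R 0) * Real.exp (R t + ε * t) * ε := by positivity
      linarith
    · intro x v hv
      simp only [mul_zero, add_zero]
      rw [mul_assoc C, ← Real.exp_add, neg_add_cancel, Real.exp_zero, mul_one]
      exact hC' x v hv
  have hlim : Tendsto (fun ε : ℝ => C * Real.exp (-R 0) * Real.exp (R t + ε * t) * (k t x v v).re)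
      (𝓝[>] 0) (𝓝 (C * Real.exp (-R 0) * Real.exp (R t) * (k t x v v).re)) := by
    have : Continuous fun ε : ℝ =>
        C * Real.exp (-R 0) * Real.exp (R t + ε * t) * (k t x v v).re := by fun_prop
    simpa using (this.tendsto 0).mono_left nhdsWithin_le_nhds
  refine ge_of_tendsto hlim ?_
  filter_upwards [self_mem_nhdsWithin] with ε hε
  exact (key ε hε).le

end Comparison

/-! ### The metrics defined by a solution of the gauge flow -/

section GaugeFlow

open Matrix

variable {V : Type*} [NormedAddCommGroup V] [NormedSpace ℂ V]
  {X : Type*} [TopologicalSpace X] [ChartedSpace V X]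
  {F : Type*} [NormedAddCommGroup F] [NormedSpace ℂ F] [FiniteDimensional ℂ F]
  {E : X → Type*} [∀ x, AddCommGroup (E x)] [∀ x, Module ℂ (E x)] [∀ x, TopologicalSpace (E x)]
  [TopologicalSpace (TotalSpace F E)] [FiberBundle F E] [VectorBundle ℂ F E]
  {H : SesqField E} {g : ℝ → ∀ x, E x ≃ₗ[ℂ] E x}

theorem IsPosHermitian.pullbackMetric {X : Type*} {E : X → Type*} [∀ x, AddCommGroup (E x)]
    [∀ x, Module ℂ (E x)] {H : SesqField E} (hH : IsPosHermitian H) (g : ∀ x, E x ≃ₗ[ℂ] E x) :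
    IsPosHermitian (pullbackMetric H g) := fun x =>
  ⟨fun v w => (hH x).1 (g x v) (g x w),
    fun v hv => (hH x).2 (g x v) ((g x).map_eq_zero_iff.not.mpr hv)⟩

theorem IsHermitianMetric.matContDiffAt (hH : IsHermitianMetric V F H) (x : X) :
    MatContDiffAt 2 (fun y => gramMatrix F (trivializationAt F E x) H ((chartAt V x).symm y))
      (chartAt V x x) := fun i j =>
  (((hH.smooth (trivializationAt F E x) i j).contMDiffAt
    ((trivializationAt F E x).open_baseSet.mem_nhds
      (mem_baseSet_trivializationAt F E x))).contDiffAt_chart).of_le (WithTop.coe_le_coe.mpr le_top)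

theorem IsSmoothEndFamily.matContDiffAt {A : ℝ → EndField E} (hA : IsSmoothEndFamily V F A)
    {t : ℝ} (ht : 0 ≤ t) (x : X) :
    MatContDiffAt 2 (fun y => endMatrix F (trivializationAt F E x) ((chartAt V x).symm y)
      (A t ((chartAt V x).symm y))) (chartAt V x x) := fun i j =>
  (ContMDiffAt.contDiffAt_chart (contMDiffAt_slice (trivializationAt F E x).open_baseSet
    (hA (trivializationAt F E x) i j) ht (mem_baseSet_trivializationAt F E x))).of_le
    (WithTop.coe_le_coe.mpr le_top)

theorem isRegularMetricFamily_pullbackMetric (hH : IsHermitianMetric V F H)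
    (hg : IsSmoothEndFamily V F (fun t x => (g t x : Module.End ℂ (E x)))) :
    IsRegularMetricFamily V F fun t => pullbackMetric H (g t) where
  posHermitian t _ := hH.posHermitian.pullbackMetric (g t)
  continuousOn e _ i j := by
    have hG := fun i j => (hg e i j).continuousOn
    have hHc : ∀ i j, ContinuousOn (fun p : ℝ × X => gramMatrix F e H p.2 i j)
        (Ici 0 ×ˢ e.baseSet) := fun i j =>
      (hH.smooth e i j).continuousOn.comp continuousOn_snd fun p hp => hp.2
    refine ContinuousOn.congr (f := fun p : ℝ × X =>
      ∑ l, (∑ m, conj (endMatrix F e p.2 (g p.1 p.2 : Module.End ℂ (E p.2)) m i) *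
        gramMatrix F e H p.2 m l) * endMatrix F e p.2 (g p.1 p.2 : Module.End ℂ (E p.2)) l j)
      ?_ fun p hp => ?_
    · refine continuousOn_finsetSum _ fun l _ => ContinuousOn.mul
        (continuousOn_finsetSum _ fun m _ => ContinuousOn.mul ?_ (hHc m l)) (hG l j)
      exact Complex.continuous_conj.comp_continuousOn (hG m i)
    · simp only [gramMatrix_pullbackMetric hp.2, Matrix.mul_apply, conjTranspose_apply,
        Complex.star_def]
  contDiffAt t ht x := by
    have hG := hg.matContDiffAt ht x
    refine ((hG.conjTranspose.mul (hH.matContDiffAt x)).mul hG).congr ?_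
    filter_upwards [eventually_chartAt_symm_mem (V := V) (trivializationAt F E x).open_baseSet
      (mem_baseSet_trivializationAt F E x)] with y hy
    exact gramMatrix_pullbackMetric hy H (g t)

theorem hasDerivWithinAt_pullbackMetric
    (hg : IsSmoothEndFamily V F (fun t x => (g t x : Module.End ℂ (E x))))
    {t : ℝ} (ht : 0 ≤ t) (x : X) (v : E x) :
    HasDerivWithinAt (fun τ => pullbackMetric H (g τ) x v v)
      (H x (timeDeriv F (fun τ y => (g τ y : Module.End ℂ (E y))) t x v) (g t x v) +
        H x (g t x v) (timeDeriv F (fun τ y => (g τ y : Module.End ℂ (E y))) t x v)) (Ici 0) t := by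
  have hx := mem_baseSet_trivializationAt F E x
  obtain ⟨c, rfl⟩ := exists_frameVec_eq hx v
  let G : ℝ → Matrix _ _ ℂ := fun τ =>
    endMatrix F (trivializationAt F E x) x (g τ x : Module.End ℂ (E x))
  let G' : Matrix (Fin (Module.finrank ℂ F)) (Fin (Module.finrank ℂ F)) ℂ :=
    Matrix.of fun i j => derivWithin (fun τ => G τ i j) (Ici 0) t
  have hG : ∀ i j, HasDerivWithinAt (fun τ => G τ i j) (G' i j) (Ici 0) t := fun i j =>
    (differentiableOn_time (hg (trivializationAt F E x) i j) hx t ht).hasDerivWithinAt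
  have hGc : ∀ i, HasDerivWithinAt (fun τ => (G τ *ᵥ c) i) ((G' *ᵥ c) i) (Ici 0) t := fun i => by
    simp only [mulVec, dotProduct]
    exact HasDerivWithinAt.fun_sum fun j _ => (hG i j).mul_const _
  have hgτ : ∀ τ, g τ x (frameVec (trivializationAt F E x) x c) =
      frameVec (trivializationAt F E x) x (G τ *ᵥ c) := fun τ =>
    end_frameVec hx (g τ x : Module.End ℂ (E x)) c
  have hg' : timeDeriv F (fun τ y => (g τ y : Module.End ℂ (E y))) t x
      (frameVec (trivializationAt F E x) x c) = frameVec (trivializationAt F E x) x (G' *ᵥ c) :=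
    endOfMatrix_frameVec hx _ _
  have hp : ∀ τ, pullbackMetric H (g τ) x (frameVec (trivializationAt F E x) x c)
      (frameVec (trivializationAt F E x) x c) =
        H x (g τ x (frameVec _ x c)) (g τ x (frameVec _ x c)) :=
    fun τ => rfl
  simp only [hp, hg', hgτ, apply_frameVec, dotProduct, mulVec, Pi.star_apply]
  rw [← Finset.sum_add_distrib]
  refine HasDerivWithinAt.fun_sum fun i _ => HasDerivWithinAt.mul ?_
    (HasDerivWithinAt.fun_sum fun j _ => (hGc j).const_mul _)
  exact (Complex.conjCLE : ℂ ≃L[ℝ] ℂ).hasFDerivAt.comp_hasDerivWithinAt t (hGc i)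

variable [FiniteDimensional ℂ V] {κ : KaehlerForm V X} {lam : ℂ} {s : ℝ → EndField E}

/-- The time derivative of the metrics defined by a solution of the perturbed gauge flow. -/
theorem SolvesGaugeFlowUpTo.hasDerivWithinAt (hflow : SolvesGaugeFlowUpTo F κ lam H g s)
    (hH : IsHermitianMetric V F H)
    (hg : IsSmoothEndFamily V F (fun t x => (g t x : Module.End ℂ (E x))))
    {t : ℝ} (ht : 0 ≤ t) (x : X) (v : E x) :
    HasDerivWithinAt (fun τ => (pullbackMetric H (g τ) x v v).re)
      ((pullbackMetric H (g t) x v ((-(2 * Complex.I) •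
        (metricCurvature F κ (pullbackMetric H (g t)) x - lam • 1)) v)).re +
        2 * (H x (g t x v) (s t x (g t x v))).re) (Ici 0) t := by
  have h1 := hasDerivWithinAt_pullbackMetric (H := H) hg ht x v
  have h2 := Complex.reCLM.hasFDerivAt.comp_hasDerivWithinAt t h1
  refine h2.congr_deriv ?_
  -- Evaluated on `g v`, the endomorphism `∂_t g g⁻¹` gives `(∂_t g) v`, so twice the left side of
  -- the gauge equation is the derivative of `H(gv, gv)`.
  have h3 := hflow t ht x (g t x v) (g t x v)
  simp only [LinearMap.comp_apply, LinearEquiv.coe_coe, LinearEquiv.symm_apply_apply] at h3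
  have h4 := gaugeCurvature_apply κ hH.posHermitian x (hH.matContDiffAt x)
    (hg.matContDiffAt ht x) v
  have h5 : ∀ w, pullbackMetric H (g t) x v w = H x (g t x v) (g t x w) := fun w => rfl
  rw [Complex.reCLM_apply, add_comm, ← Complex.re_ofReal_mul, ← Complex.add_re]
  congr 1
  simp only [LinearMap.add_apply, LinearMap.smul_apply, LinearMap.sub_apply,
    Module.End.one_apply, map_add, map_smul, map_sub, h4, h5, smul_eq_mul] at h3 ⊢
  push_cast
  linear_combination 2 * h3

theorem SolvesGaugeFlowUpTo.isSubsolution (hflow : SolvesGaugeFlowUpTo F κ lam H g s)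
    (hH : IsHermitianMetric V F H)
    (hg : IsSmoothEndFamily V F (fun t x => (g t x : Module.End ℂ (E x)))) {f : ℝ → ℝ}
    (hs_le : ∀ t, 0 ≤ t → ∀ x, ∀ v : E x, (H x v (s t x v)).re ≤ f t * (H x v v).re) :
    IsSubsolution F κ lam (fun t => 2 * f t) fun t => pullbackMetric H (g t) := fun t ht x v => by
  refine ⟨_, hflow.hasDerivWithinAt hH hg ht x v, ?_⟩
  have := hs_le t ht x (g t x v)
  change _ ≤ _ + 2 * f t * (H x (g t x v) (g t x v)).re
  linarith

theorem SolvesGaugeFlowUpTo.isSupersolution (hflow : SolvesGaugeFlowUpTo F κ lam H g s)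
    (hH : IsHermitianMetric V F H)
    (hg : IsSmoothEndFamily V F (fun t x => (g t x : Module.End ℂ (E x)))) {f : ℝ → ℝ}
    (hs_le : ∀ t, 0 ≤ t → ∀ x, ∀ v : E x, -f t * (H x v v).re ≤ (H x v (s t x v)).re) :
    IsSupersolution F κ lam (fun t => 2 * f t) fun t => pullbackMetric H (g t) :=
    fun t ht x v => by
  refine ⟨_, hflow.hasDerivWithinAt hH hg ht x v, ?_⟩
  have := hs_le t ht x (g t x v)
  change _ - 2 * f t * (H x (g t x v) (g t x v)).re ≤ _
  linarith

theorem IsExactSolution.hasDerivWithinAt {k : ℝ → SesqField E} (hk : IsExactSolution F κ lam k)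
    {t : ℝ} (ht : 0 ≤ t) (x : X) (v : E x) :
    HasDerivWithinAt (fun τ => (k τ x v v).re)
      (k t x v ((-(2 * Complex.I) • (metricCurvature F κ (k t) x - lam • 1)) v)).re (Ici 0) t :=
  Complex.reCLM.hasFDerivAt.comp_hasDerivWithinAt t (hk.flow t ht x v v)

theorem IsExactSolution.isSubsolution {k : ℝ → SesqField E} (hk : IsExactSolution F κ lam k) :
    IsSubsolution F κ lam (fun _ => 0) k := fun t ht x v =>
  ⟨_, hk.hasDerivWithinAt ht x v, by simp⟩

theorem IsExactSolution.isSupersolution {k : ℝ → SesqField E} (hk : IsExactSolution F κ lam k) :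
    IsSupersolution F κ lam (fun _ => 0) k := fun t ht x v =>
  ⟨_, hk.hasDerivWithinAt ht x v, by simp⟩

end GaugeFlow

/-- A continuous integrable function on `[0, ∞)` has a bounded primitive. -/
theorem exists_bounded_primitive {f : ℝ → ℝ} (hf : ContinuousOn f (Ici 0))
    (hf_nonneg : ∀ t, 0 ≤ t → 0 ≤ f t) (hf_int : IntegrableOn f (Ici 0)) :
    ∃ (R : ℝ → ℝ) (K : ℝ), Continuous R ∧ (∀ t, 0 < t → HasDerivAt R (f t) t) ∧
      ∀ t, 0 ≤ t → R t ≤ K := by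
  -- Nothing is known about `f` on negative times; freezing it at `f 0` there gives a continuous
  -- integrand on the whole line.
  have hc : Continuous fun t => f (max t 0) :=
    hf.comp_continuous (by fun_prop) fun t => le_max_right t 0
  have hd : ∀ t, HasDerivAt (fun t => ∫ u in (0 : ℝ)..t, f (max u 0)) (f (max t 0)) t := fun t =>
    (hc.integral_hasStrictDerivAt 0 t).hasDerivAt
  refine ⟨fun t => ∫ u in (0 : ℝ)..t, f (max u 0), ∫ u in Ici 0, f u,
    continuous_iff_continuousAt.mpr fun t => (hd t).continuousAt, fun t ht => ?_, fun t ht => ?_⟩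
  · simpa only [max_eq_left ht.le] using hd t
  · beta_reduce
    rw [intervalIntegral.integral_of_le ht]
    have : ∫ u in Ioc 0 t, f (max u 0) = ∫ u in Ioc 0 t, f u :=
      setIntegral_congr_fun measurableSet_Ioc fun u hu => by
        simp only [max_eq_left hu.1.le]
    rw [this]
    refine setIntegral_mono_set hf_int ?_ (LE.le.eventuallyLE fun u hu => hu.1.le)
    filter_upwards [ae_restrict_mem measurableSet_Ici] with u hu using hf_nonneg u hu

end

/-! ### The two-sided bound -/

theorem mainTheorem3
    {V : Type*} [NormedAddCommGroup V] [NormedSpace ℂ V] [FiniteDimensional ℂ V]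
    {X : Type*} [TopologicalSpace X] [T2Space X] [CompactSpace X] [ChartedSpace V X]
    [IsManifold 𝓘(ℂ, V) ω X]
    {F : Type*} [NormedAddCommGroup F] [NormedSpace ℂ F] [FiniteDimensional ℂ F]
    {E : X → Type*} [∀ x, AddCommGroup (E x)] [∀ x, Module ℂ (E x)]
    [∀ x, TopologicalSpace (E x)] [TopologicalSpace (TotalSpace F E)] [FiberBundle F E]
    [VectorBundle ℂ F E] [ContMDiffVectorBundle ω F E 𝓘(ℂ, V)]
    (κ : KaehlerForm V X) (lam : ℂ)
    (H : SesqField E) (hH : IsHermitianMetric V F H)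
    (g : ℝ → ∀ x, E x ≃ₗ[ℂ] E x)
    (hg : IsSmoothEndFamily V F (fun t x => (g t x : Module.End ℂ (E x))))
    (s : ℝ → EndField E) (hs : IsSmoothEndFamily V F s)
    (hs_adj : ∀ t, 0 ≤ t → ∀ x, ∀ v w : E x, H x (s t x v) w = H x v (s t x w))
    (f : ℝ → ℝ) (hf : ContDiffOn ℝ ∞ f (Ici 0)) (hf_nonneg : ∀ t, 0 ≤ t → 0 ≤ f t)
    (hf_int : IntegrableOn f (Ici 0))
    (hs_le : ∀ t, 0 ≤ t → ∀ x, ∀ v : E x,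
      -f t * (H x v v).re ≤ (H x v (s t x v)).re ∧ (H x v (s t x v)).re ≤ f t * (H x v v).re)
    (hflow : SolvesGaugeFlowUpTo F κ lam H g s) :
    IsAsymptoticSolution F κ lam (fun t => pullbackMetric H (g t)) := by
  intro k hk
  obtain ⟨R, K, hRc, hR', hRK⟩ := exists_bounded_primitive hf.continuousOn hf_nonneg hf_int
  have hh := isRegularMetricFamily_pullbackMetric hH hg
  have hkr := hk.metric.isRegularMetricFamily
  -- The total error is `2f` in both comparisons, the exact solution contributing `0`.
  have hd : ∀ t, 0 < t → HasDerivAt (fun t => 2 * R t) (2 * f t) t := fun t ht =>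
    (hR' t ht).const_mul 2
  obtain ⟨C₁, hC₁, h₁⟩ := exists_comparison κ lam hh hkr
    (hflow.isSubsolution hH hg fun t ht x v => (hs_le t ht x v).2) hk.isSupersolution
    (R := fun t => 2 * R t) (by fun_prop) fun t ht => by simpa using hd t ht
  obtain ⟨C₂, hC₂, h₂⟩ := exists_comparison κ lam hkr hh hk.isSubsolution
    (hflow.isSupersolution hH hg fun t ht x v => (hs_le t ht x v).1)
    (R := fun t => 2 * R t) (by fun_prop) fun t ht => by simpa using hd t ht
  -- One constant serves both directions and all times because the primitive `R` is bounded by `K`;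
  -- this is where integrability of `f` enters.
  have hbound : ∀ C, 0 < C → C ≤ max C₁ C₂ → ∀ t, 0 ≤ t → C * Real.exp (2 * R t) ≤
      max 1 (max C₁ C₂ * Real.exp (2 * K)) := fun C hC hCle t ht => by
    refine le_trans ?_ (le_max_right _ _)
    exact mul_le_mul hCle (Real.exp_le_exp.mpr (by linarith [hRK t ht])) (Real.exp_pos _).le
      (hC.le.trans hCle)
  refine ⟨max 1 (max C₁ C₂ * Real.exp (2 * K)), le_max_left _ _, ?_⟩
  filter_upwards [eventually_ge_atTop 0] with t ht x v
  constructor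
  · rw [inv_mul_le_iff₀ (by positivity)]
    exact (h₂ t ht x v).trans (mul_le_mul_of_nonneg_right
      (hbound C₂ hC₂ (le_max_right _ _) t ht) ((hh.posHermitian t ht).re_nonneg v))
  · exact (h₁ t ht x v).trans (mul_le_mul_of_nonneg_right
      (hbound C₁ hC₁ (le_max_left _ _) t ht) ((hkr.posHermitian t ht).re_nonneg v))
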